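/- Let $l\ge 4$ and let $\mathfrak g=\mathfrak{so}_{2l}(\mathbb C)$ be the simple Lie algebra of type $D_l$, realized by the $2l\times 2l$ matrices that are skew-adjoint for the symmetric form with matrix $\begin{pmatrix}0&1\\1&0\end{pmatrix}$, with Cartan subalgebra $\{\operatorname{diag}(t_1,\dots,t_l,-t_1,\dots,-t_l)\}$ and $\mu_i(\operatorname{diag}(t,-t))=t_i$. Take the simple roots $\alpha_i=\mu_i-\mu_{i+1}$ for $i<l$ and $\alpha_l=\mu_{l-1}+\mu_l$, and let $\omega_1,\dots,\omega_l$ be the fundamental weights; so $\omega_{l-1}=\frac12(\mu_1+\dots+\mu_{l-1}-\mu_l)$ and $\omega_l=\frac12(\mu_1+\dots+\mu_l)$. For a dominant integral weight $\lambda$ let $V_\lambda$ be the finite-dimensional irreducible $\mathfrak g$-module with highest weight $\lambda$ and $\pi_\lambda$ its representation. On $V_\lambda\otimes V_\nu$ put $M_{\lambda,\nu}(C)=\sum_i\pi_\lambda(x_i)\otimes\pi_\nu(x_i^*)$, where $(x_i)$ is a basis of $\mathfrak g$ and $(x_i^*)$ its dual basis with respect to the Killing form; this operator does not depend on the basis and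 acts by a scalar on each of the irreducible components considered below. (1) There is a dominant integral weight $\nu$ such that $V_{\omega_{l-1}}\otimes V_\nu$ has two irreducible components, with different highest weights, on which $M_{\omega_{l-1},\nu}(C)$ has the same eigenvalue. Likewise there is a dominant integral weight $\nu$ such that $V_{\omega_l}\otimes V_\nu$ has two irreducible components, with different highest weights, on which $M_{\omega_l,\nu}(C)$ has the same eigenvalue. (2) Explicitly, let $\nu=\sum_{i=1}^l a_i\omega_i$ with integers $a_i\ge 0$, and put $\theta=\frac12(\mu_1+\dots+\mu_{l-4})$. (a) The weights $\varepsilon=\theta+\frac12(\mu_{l-3}-\mu_{l-2}-\mu_{l-1}-\mu_l)$ and $\eta=\theta+\frac12(-\mu_{l-3}+\mu_{l-2}+\mu_{l-1}+\mu_l)$ are weights of $V_{\omega_{l-1}}$. If $\nu+\varepsilon$ and $\nu+\eta$ are dominant, then $V_{\nu+\varepsilon}$ and $V_{\nu+\eta}$ are irreducible components of $V_{\omega_{l-1}}\otimes V_\nu$, and $M_{\omega_{l-1},\nu}(C)$ has the same eigenvalue on both if and only if $a_{l-3}=a_l$. (b) The weights $\varepsilon=\theta+\frac12(\mu_{l-3}-\mu_{l-2}-\mu_{l-1}+\mu_l)$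 and $\eta=\theta+\frac12(-\mu_{l-3}+\mu_{l-2}+\mu_{l-1}-\mu_l)$ are weights of $V_{\omega_l}$. If $\nu+\varepsilon$ and $\nu+\eta$ are dominant, then $V_{\nu+\varepsilon}$ and $V_{\nu+\eta}$ are irreducible components of $V_{\omega_l}\otimes V_\nu$, and $M_{\omega_l,\nu}(C)$ has the same eigenvalue on both if and only if $a_{l-3}=a_{l-1}$. -/

import Mathlib

open scoped TensorProduct

namespace SpinD

section Algebra

attribute [local instance] LieRing.ofAssociativeRing

/-- The complex simple Lie algebra of type `D_l`, i.e. `𝔰𝔬(2l, ℂ)` in its split matrix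
realization: the complex `2l × 2l` matrices that are skew-adjoint for the symmetric form with
block matrix `[0 1; 1 0]`.  Its diagonal matrices are `diag(t₁, …, t_l, -t₁, …, -t_l)`. -/
def SoEven (l : ℕ) : Type := ↥(LieAlgebra.Orthogonal.typeD (Fin l) ℂ)

noncomputable instance instLieRing (l : ℕ) : LieRing (SoEven l) :=
  inferInstanceAs (LieRing ↥(LieAlgebra.Orthogonal.typeD (Fin l) ℂ))

noncomputable instance instLieAlgebra (l : ℕ) : LieAlgebra ℂ (SoEven l) :=
  inferInstanceAs (LieAlgebra ℂ ↥(LieAlgebra.Orthogonal.typeD (Fin l) ℂ))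

instance instFiniteDimensional (l : ℕ) : FiniteDimensional ℂ (SoEven l) :=
  inferInstanceAs (FiniteDimensional ℂ
    ↥(LieAlgebra.Orthogonal.typeD (Fin l) ℂ).toSubmodule)

/-- The matrix underlying an element of the Lie algebra. -/
def SoEven.mat {l : ℕ} (X : SoEven l) : Matrix (Fin l ⊕ Fin l) (Fin l ⊕ Fin l) ℂ := X.1

theorem mem_typeD_iff {l : ℕ} (A : Matrix (Fin l ⊕ Fin l) (Fin l ⊕ Fin l) ℂ) :
    A ∈ LieAlgebra.Orthogonal.typeD (Fin l) ℂ ↔ ∀ p q, A q.swap p = - A p.swap q := by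
  have key : A ∈ LieAlgebra.Orthogonal.typeD (Fin l) ℂ ↔
      A.transpose * LieAlgebra.Orthogonal.JD (Fin l) ℂ =
        LieAlgebra.Orthogonal.JD (Fin l) ℂ * (-A) := by
    simp only [LieAlgebra.Orthogonal.typeD, mem_skewAdjointMatricesLieSubalgebra,
      mem_skewAdjointMatricesSubmodule]
    rfl
  have h1 : ∀ p q, (A.transpose * LieAlgebra.Orthogonal.JD (Fin l) ℂ) p q = A q.swap p := by
    intro p q
    rcases q with q | q <;>
      simp [LieAlgebra.Orthogonal.JD, Matrix.mul_apply, Matrix.one_apply]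
  have h2 : ∀ p q, (LieAlgebra.Orthogonal.JD (Fin l) ℂ * (-A)) p q = - A p.swap q := by
    intro p q
    rcases p with p | p <;>
      simp [LieAlgebra.Orthogonal.JD, Matrix.mul_apply, Matrix.one_apply]
  rw [key, ← Matrix.ext_iff]
  simp only [h1, h2]

/-- The Lie algebra is the set of matrices with `A q' p = - A p' q`, where `p ↦ p'` exchanges the
two blocks of indices. -/
def SoEven.ofMat {l : ℕ} (A : Matrix (Fin l ⊕ Fin l) (Fin l ⊕ Fin l) ℂ)
    (h : ∀ p q, A q.swap p = - A p.swap q) : SoEven l :=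
  ⟨A, (mem_typeD_iff A).mpr h⟩

/-- The element `diag(t₁, …, t_l, -t₁, …, -t_l)` of the Cartan subalgebra. -/
def cartan {l : ℕ} (t : Fin l → ℂ) : SoEven l :=
  SoEven.ofMat (Matrix.diagonal (Sum.elim t (-t))) <| by
    rintro (p | p) (q | q) <;> simp [Matrix.diagonal_apply]
    all_goals (split_ifs <;> simp_all)

/-- The matrix `E_{p q'} - E_{q p'}`. -/
def gen {l : ℕ} (p q : Fin l ⊕ Fin l) : SoEven l :=
  SoEven.ofMat (Matrix.single p q.swap 1 - Matrix.single q p.swap 1) <| by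
    intro a b
    rcases a with a | a <;> rcases b with b | b <;> rcases p with p | p <;> rcases q with q | q <;>
      simp [Matrix.single_apply, and_comm]

/-- The natural action on `ℂ^{2l}`. -/
noncomputable local instance naturalLieRingModule (l : ℕ) : LieRingModule (SoEven l) (Fin l ⊕ Fin l → ℂ) :=
  inferInstanceAs (LieRingModule ↥(LieAlgebra.Orthogonal.typeD (Fin l) ℂ) (Fin l ⊕ Fin l → ℂ))

local instance naturalLieModule (l : ℕ) : LieModule ℂ (SoEven l) (Fin l ⊕ Fin l → ℂ) :=
  inferInstanceAs (LieModule ℂ ↥(LieAlgebra.Orthogonal.typeD (Fin l) ℂ) (Fin l ⊕ Fin l → ℂ))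

theorem natural_lie {l : ℕ} (X : SoEven l) (v : Fin l ⊕ Fin l → ℂ) :
    ⁅X, v⁆ = X.mat.mulVec v := rfl

theorem gen_lie {l : ℕ} (p q : Fin l ⊕ Fin l) (v : Fin l ⊕ Fin l → ℂ) :
    ⁅gen p q, v⁆ = v q.swap • Pi.single p (1 : ℂ) - v p.swap • Pi.single q (1 : ℂ) := by
  rw [natural_lie]
  change (Matrix.single p q.swap 1 - Matrix.single q p.swap 1 : Matrix _ _ ℂ).mulVec v = _
  rw [Matrix.sub_mulVec, Matrix.single_mulVec, Matrix.single_mulVec]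
  ext a
  simp [Pi.single_apply, Function.update_apply]

theorem natural_irreducible {l : ℕ} (hl : 2 ≤ l) :
    LieModule.IsIrreducible ℂ (SoEven l) (Fin l ⊕ Fin l → ℂ) := by
  have : Nonempty (Fin l ⊕ Fin l) := ⟨Sum.inl ⟨0, by omega⟩⟩
  have hex : ∀ q : Fin l ⊕ Fin l, ∃ p : Fin l ⊕ Fin l, p ≠ q ∧ p ≠ q.swap := by
    intro q
    obtain ⟨i, hi⟩ : ∃ i : Fin l, i ≠ Sum.elim id id q := by
      have : Nontrivial (Fin l) := Fin.nontrivial_iff_two_le.mpr hl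
      exact exists_ne _
    refine ⟨Sum.inl i, ?_, ?_⟩ <;> rcases q with q | q <;> simp at hi ⊢ <;> exact hi
  have hss : ∀ q : Fin l ⊕ Fin l, q.swap ≠ q := by rintro (q | q) <;> simp
  refine LieModule.IsIrreducible.mk fun N hN => ?_
  obtain ⟨v, hvN, hv⟩ : ∃ v ∈ N, v ≠ 0 := by
    by_contra h
    push Not at h
    exact hN ((LieSubmodule.eq_bot_iff N).mpr h)
  obtain ⟨q', hq'⟩ := Function.ne_iff.mp hv
  obtain ⟨q, rfl⟩ : ∃ q : Fin l ⊕ Fin l, q' = q.swap := ⟨q'.swap, by simp⟩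
  obtain ⟨p, hp1, hp2⟩ := hex q
  have hp3 : q ≠ p.swap := by rintro rfl; simp at hp2
  have hp : Pi.single p (1 : ℂ) ∈ N := by
    have h1 := N.lie_mem (x := gen p p.swap) (N.lie_mem (x := gen p q) hvN)
    rw [gen_lie, gen_lie] at h1
    have : (v q.swap)⁻¹ • v q.swap • Pi.single p (1 : ℂ) ∈ N := by
      refine N.smul_mem _ ?_
      simpa [Pi.single_apply, hp1, hp2, hp3, hss, hp1.symm, hp3.symm, (hss _).symm] using h1
    rwa [smul_smul, inv_mul_cancel₀ (by simpa using hq'), one_smul] at this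
  have step : ∀ a b : Fin l ⊕ Fin l, b ≠ a.swap → Pi.single a (1 : ℂ) ∈ N →
      Pi.single b (1 : ℂ) ∈ N := by
    intro a b hab ha
    have hab' : b.swap ≠ a := by rintro rfl; simp at hab
    have h1 := N.lie_mem (x := gen b a.swap) ha
    rw [gen_lie] at h1
    simpa [Pi.single_apply, hab'] using h1
  have all : ∀ b, Pi.single b (1 : ℂ) ∈ N := by
    intro b
    by_cases hb : b = p.swap
    · obtain ⟨r, hr1, hr2⟩ := hex p
      refine step r b ?_ (step p r hr2 hp)
      rintro rfl
      exact hr1 (by simpa using congrArg Sum.swap hb)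
    · exact step p b hb hp
  rw [eq_top_iff]
  intro w _
  rw [pi_eq_sum_univ' w]
  exact N.sum_mem fun b _ => N.smul_mem _ (all b)

theorem trace_natural {l : ℕ} (X : SoEven l) :
    LinearMap.trace ℂ _ (LieModule.toEnd ℂ (SoEven l) (Fin l ⊕ Fin l → ℂ) X) = 0 := by
  have h : LieModule.toEnd ℂ (SoEven l) (Fin l ⊕ Fin l → ℂ) X = Matrix.toLin' X.mat := by
    ext v; rfl
  rw [h, Matrix.trace_toLin'_eq]
  have := (mem_typeD_iff X.mat).mp X.2
  simp only [Matrix.trace, Matrix.diag, Fintype.sum_sum_type, ← Finset.sum_add_distrib]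
  refine Finset.sum_eq_zero fun i _ => ?_
  have := this (Sum.inl i) (Sum.inr i)
  simp only [Sum.swap_inr, Sum.swap_inl] at this
  rw [this]; ring

/-- The Killing form of `𝔰𝔬(2l, ℂ)` is nondegenerate, so dual bases for it make sense. -/
theorem killingForm_nondegenerate {l : ℕ} (hl : 2 ≤ l) :
    (killingForm ℂ (SoEven l)).Nondegenerate := by
  have := natural_irreducible hl
  have : LieModule.IsFaithful ℂ (SoEven l) (Fin l ⊕ Fin l → ℂ) :=
    inferInstanceAs (LieModule.IsFaithful ℂ
      ↥(LieAlgebra.Orthogonal.typeD (Fin l) ℂ) (Fin l ⊕ Fin l → ℂ))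
  have := LieAlgebra.hasTrivialRadical_of_isIrreducible_of_isFaithful ℂ (SoEven l)
    (Fin l ⊕ Fin l → ℂ) trace_natural
  exact LieAlgebra.IsKilling.killingForm_nondegenerate ℂ (SoEven l)

end Algebra

/-! Weights.  A linear form on the Cartan subalgebra is written in coordinates `Fin l → ℂ` with
respect to `μ₁, …, μ_l`, where `μ_i (diag(t, -t)) = t_i`; the index `i : Fin l` stands for the
`(i+1)`-st coordinate, simple root or fundamental weight.  The positive roots are `μ_i ± μ_j` for
`i < j`, with simple roots `α_i = μ_i - μ_{i+1}` (`i < l`) and `α_l = μ_{l-1} + μ_l`. -/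

section Weights

/-- The value of the weight `lam` at the Cartan element `diag(t, -t)`. -/
def evalWeight {l : ℕ} (lam t : Fin l → ℂ) : ℂ := ∑ i, lam i * t i

/-- The simple coroots, as diagonal parts `t`: `e_j - e_{j+1}` for all but the last index, and
`e_{l-1} + e_l` (in one-based notation) for the last one. -/
def simpleCoroot (l : ℕ) (j : Fin l) : Fin l → ℂ := fun i =>
  if j.val + 1 < l then
    (if i = j then 1 else if i.val = j.val + 1 then -1 else 0)
  else
    (if i = j ∨ i.val + 1 = j.val then 1 else 0)

/-- The Dynkin label `2(lam, α_j)/(α_j, α_j)`. -/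
def dynkinLabel {l : ℕ} (lam : Fin l → ℂ) (j : Fin l) : ℂ := evalWeight lam (simpleCoroot l j)

/-- Dominant integral weights. -/
def IsDominant {l : ℕ} (lam : Fin l → ℂ) : Prop := ∀ j, ∃ n : ℕ, dynkinLabel lam j = n

/-- The fundamental weights: `μ₁ + ⋯ + μ_k` for `k ≤ l - 2`, then
`(μ₁ + ⋯ + μ_{l-1} - μ_l)/2` and `(μ₁ + ⋯ + μ_{l-1} + μ_l)/2` (one-based notation). -/
noncomputable def fundWeight (l : ℕ) (k : Fin l) : Fin l → ℂ := fun i =>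
  if k.val + 2 < l then (if i ≤ k then 1 else 0)
  else if k.val + 2 = l then (if i.val + 1 = l then -(1 / 2) else 1 / 2)
  else 1 / 2

theorem dynkinLabel_eq_of_lt {l : ℕ} (lam : Fin l → ℂ) (j : Fin l)
    (hj : j.val + 1 < l) : dynkinLabel lam j = lam j - lam ⟨j.val + 1, hj⟩ := by
  have h : ∀ i : Fin l, lam i * simpleCoroot l j i =
      (if i = j then lam i else 0) - (if i = ⟨j.val + 1, hj⟩ then lam i else 0) := by
    intro i
    simp only [simpleCoroot, hj, if_true, Fin.ext_iff]
    split_ifs <;> first | omega | simp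
  simp only [dynkinLabel, evalWeight, h, Finset.sum_sub_distrib]
  simp

theorem dynkinLabel_last {l : ℕ} (lam : Fin l → ℂ) (hl : 2 ≤ l) :
    dynkinLabel lam ⟨l - 1, by omega⟩ =
      lam ⟨l - 2, by omega⟩ + lam ⟨l - 1, by omega⟩ := by
  have h : ∀ i : Fin l, lam i * simpleCoroot l ⟨l - 1, by omega⟩ i =
      (if i = ⟨l - 2, by omega⟩ then lam i else 0) +
        (if i = ⟨l - 1, by omega⟩ then lam i else 0) := by
    intro i
    simp only [simpleCoroot, Fin.ext_iff]
    split_ifs <;> first | omega | simp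
  simp only [dynkinLabel, evalWeight, h, Finset.sum_add_distrib]
  simp

/-- The fundamental weights are dual to the simple coroots. -/
theorem dynkinLabel_fundWeight {l : ℕ} (hl : 2 ≤ l) (k j : Fin l) :
    dynkinLabel (fundWeight l k) j = if j = k then 1 else 0 := by
  by_cases hj : j.val + 1 < l
  · rw [dynkinLabel_eq_of_lt _ _ hj]
    simp only [fundWeight, Fin.ext_iff, Fin.le_def]
    split_ifs <;> first | omega | norm_num
  · have hj' : j = ⟨l - 1, by omega⟩ := Fin.ext (by simp only; omega)
    rw [hj', dynkinLabel_last _ hl]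
    simp only [fundWeight, Fin.ext_iff, Fin.le_def]
    split_ifs <;> first | omega | norm_num

/-- The dominant integral weight `∑ a_k ω_k`. -/
noncomputable def weightOfLabels {l : ℕ} (a : Fin l → ℕ) : Fin l → ℂ :=
  ∑ k, (a k : ℂ) • fundWeight l k

/-- The weight `(μ₁ + ⋯ + μ_{l-4} + s₁ μ_{l-3} + s₂ μ_{l-2} + s₃ μ_{l-1} + s₄ μ_l) / 2`
(one-based notation). -/
noncomputable def spinWeight (l : ℕ) (s₁ s₂ s₃ s₄ : ℂ) : Fin l → ℂ := fun i =>
  if i.val + 4 < l then 1 / 2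
  else if i.val + 4 = l then s₁ / 2
  else if i.val + 3 = l then s₂ / 2
  else if i.val + 2 = l then s₃ / 2
  else s₄ / 2

end Weights

section Modules

/-- The sum `𝔫⁺` of the positive root spaces: matrices `[a b; 0 -aᵀ]` of the Lie algebra with `a`
strictly upper triangular. -/
def IsPositive {l : ℕ} (X : SoEven l) : Prop :=
  (∀ i j : Fin l, j ≤ i → X.mat (Sum.inl i) (Sum.inl j) = 0) ∧
    ∀ i j : Fin l, X.mat (Sum.inr i) (Sum.inl j) = 0

/-- `v` is a (nonzero) weight vector of weight `lam`. -/
def IsWeightVector {l : ℕ} (lam : Fin l → ℂ) {V : Type*} [AddCommGroup V] [Module ℂ V]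
    [LieRingModule (SoEven l) V] (v : V) : Prop :=
  v ≠ 0 ∧ ∀ t : Fin l → ℂ, ⁅(cartan t : SoEven l), v⁆ = evalWeight lam t • v

/-- `lam` belongs to the set `Π(V)` of weights of `V`. -/
def IsWeightOf {l : ℕ} (lam : Fin l → ℂ) (V : Type*) [AddCommGroup V] [Module ℂ V]
    [LieRingModule (SoEven l) V] : Prop :=
  ∃ v : V, IsWeightVector lam v

/-- `V` is a finite-dimensional irreducible module with highest weight `lam`; this determines `V`
up to isomorphism, so it says that `V` is (a model of) `V_lam`. -/
structure IsIrrep {l : ℕ} (lam : Fin l → ℂ) (V : Type*) [AddCommGroup V] [Module ℂ V]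
    [LieRingModule (SoEven l) V] [LieModule ℂ (SoEven l) V] : Prop where
  finiteDimensional : FiniteDimensional ℂ V
  irreducible : LieModule.IsIrreducible ℂ (SoEven l) V
  highestWeight : ∃ v : V, IsWeightVector lam v ∧ ∀ X : SoEven l, IsPositive X → ⁅X, v⁆ = 0

/-- There is a model of `V_lam`. -/
def IrrepExists {l : ℕ} (lam : Fin l → ℂ) : Prop :=
  ∃ (V : Type) (_ : AddCommGroup V) (_ : Module ℂ V) (_ : LieRingModule (SoEven l) V)
    (_ : LieModule ℂ (SoEven l) V), IsIrrep lam V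

/-- The operator `M(C) = ∑ π_V(x_i) ⊗ π_W(x_i^*)` on `V ⊗ W`, where `x_i^*` is the basis dual to
`x_i` for the Killing form. -/
noncomputable def mOperator {l : ℕ} (hl : 2 ≤ l) {m : ℕ}
    (x : Module.Basis (Fin m) ℂ (SoEven l)) (V W : Type*)
    [AddCommGroup V] [Module ℂ V] [LieRingModule (SoEven l) V] [LieModule ℂ (SoEven l) V]
    [AddCommGroup W] [Module ℂ W] [LieRingModule (SoEven l) W] [LieModule ℂ (SoEven l) W] :
    Module.End ℂ (V ⊗[ℂ] W) :=
  ∑ i, TensorProduct.map (LieModule.toEnd ℂ (SoEven l) V (x i))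
    (LieModule.toEnd ℂ (SoEven l) W
      (LinearMap.BilinForm.dualBasis (killingForm ℂ (SoEven l)) (killingForm_nondegenerate hl)
        x i))

/-- `N` is an irreducible component `V_sig` of `V ⊗ W` (an irreducible submodule with highest weight
`sig`; finite-dimensional modules of the simple Lie algebra are completely reducible), and the operator `M(C)`, formed with any
basis of the Lie algebra, acts on it by the scalar `c`. -/
def IsComponentWithMEigenvalue {l : ℕ} (hl : 2 ≤ l) {V W : Type*}
    [AddCommGroup V] [Module ℂ V] [LieRingModule (SoEven l) V] [LieModule ℂ (SoEven l) V]
    [AddCommGroup W] [Module ℂ W] [LieRingModule (SoEven l) W] [LieModule ℂ (SoEven l) W]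
    (sig : Fin l → ℂ) (N : LieSubmodule ℂ (SoEven l) (V ⊗[ℂ] W)) (c : ℂ) : Prop :=
  IsIrrep sig N ∧ ∀ (m : ℕ) (x : Module.Basis (Fin m) ℂ (SoEven l)), ∀ w ∈ N,
    mOperator hl x V W w = c • w

end Modules

end SpinD

/-! Expanding the Casimir operator on `V ⊗ W` exhibits `M(C)`, up to the normalization of the
Killing form, as half the difference between the Casimir of the tensor product and those of the
factors. On a component of highest weight σ it is therefore a fixed nonzero multiple of `(σ, σ +
2ρ)` plus a constant depending only on ω and ν (`casimir_tensor`, `isComponentWithMEigenvalue`).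
Equality on the components ν + ε and ν + η thus means `(ε - η, 2ν + ε + η + 2ρ) = 0`. The vector ε -
η lives on the last four coordinates, where it is `(1, -1, -1, ±1)`; there ε + η vanishes, and ρ is
`(3, 2, 1, 0)`, orthogonal to ε - η. Only ν survives, and the pairing is a difference of two Dynkin
labels (`evalWeight_energy_sub`, `mScalar_eq_iff`).

The longer task is to show that the components exist. Each of ε and η is ω minus three simple roots
forming an A₃ chain that starts at the spin node and passes through the branch node. For such a
chain, `chainVector` is an explicit vector of the tensor product killed by all simple raising
operators (`IsChain.raise_chainVector`). It is nonzero as soon as ν has a nonzero label at the end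
of the chain (`IsChain.chainVector_ne_zero`), and dominance of the shifted weight forces this
(`IsChain.label_ne_zero`).

A highest weight vector of a finite-dimensional module generates an irreducible submodule
(`isIrrep_lieSpan`). Complete reducibility is not used: a second highest weight μ in the submodule
generated from weight λ would have the same Casimir value, whereas `(λ - μ, λ + μ + 2ρ)` is positive
when λ - μ is a nonzero sum of positive roots.

For the first claim, models must also exist: spin modules come from the exterior algebra with its
Clifford action, and the required `V_ν` from a tensor product of a spin module with endomorphisms of
the spinor space. -/

namespace SpinD

/-! ### Root elements and the bracket in the split matrix realization. -/

section MatrixRealization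

attribute [local instance] LieRing.ofAssociativeRing

variable {l : ℕ}

theorem SoEven.mat_injective : Function.Injective (SoEven.mat : SoEven l → _) :=
  Subtype.val_injective

theorem SoEven.mat_lie (X Y : SoEven l) : ⁅X, Y⁆.mat = X.mat * Y.mat - Y.mat * X.mat := rfl

/-- The inclusion of the Lie algebra into the matrices. -/
def SoEven.matHom (l : ℕ) : SoEven l →ₗ[ℂ] Matrix (Fin l ⊕ Fin l) (Fin l ⊕ Fin l) ℂ :=
  (LieAlgebra.Orthogonal.typeD (Fin l) ℂ).toSubmodule.subtype

theorem SoEven.matHom_apply (X : SoEven l) : SoEven.matHom l X = X.mat := rfl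

theorem SoEven.mat_swap (X : SoEven l) (p q : Fin l ⊕ Fin l) :
    X.mat q.swap p = - X.mat p.swap q :=
  (mem_typeD_iff X.mat).mp X.2 p q

theorem SoEven.mat_swap_swap (X : SoEven l) (p q : Fin l ⊕ Fin l) :
    X.mat q.swap p.swap = - X.mat p q := by
  simpa using X.mat_swap p.swap q

/-- The matrix `E_{p q} - E_{q' p'}`, a root vector or a coordinate vector of the Cartan
subalgebra. -/
def rootElt (p q : Fin l ⊕ Fin l) : SoEven l := gen p q.swap

theorem rootElt_mat (p q : Fin l ⊕ Fin l) :
    (rootElt p q).mat = Matrix.single p q 1 - Matrix.single q.swap p.swap 1 := by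
  change Matrix.single p q.swap.swap 1 - Matrix.single q.swap p.swap 1 = _
  rw [Sum.swap_swap]

theorem rootElt_mat_apply (p q r s : Fin l ⊕ Fin l) :
    (rootElt p q).mat r s =
      (if r = p ∧ s = q then 1 else 0) - (if r = q.swap ∧ s = p.swap then 1 else 0) := by
  rw [rootElt_mat]
  simp [Matrix.single_apply, eq_comm]

theorem rootElt_swap (p q : Fin l ⊕ Fin l) : rootElt q.swap p.swap = - rootElt p q := by
  apply SoEven.mat_injective
  rw [← SoEven.matHom_apply, ← SoEven.matHom_apply, map_neg, SoEven.matHom_apply,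
    SoEven.matHom_apply, rootElt_mat, rootElt_mat]
  simp

/-- Antisymmetry makes this element its own negative. Such index pairs carry no root, which is why
`p ≠ q.swap` is required below. -/
theorem rootElt_self_swap (p : Fin l ⊕ Fin l) : rootElt p p.swap = 0 := by
  have h := rootElt_swap p p.swap
  simp only [Sum.swap_swap] at h
  have h2 : (2 : ℂ) • rootElt p p.swap = 0 := by
    rw [two_smul]
    nth_rewrite 1 [h]
    exact neg_add_cancel _
  exact (smul_eq_zero.mp h2).resolve_left two_ne_zero

/-- The pairs `(p, q)` and `(q', p')` give the same element up to sign, so the family is a spanning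
set counted twice; the factor 1/2 compensates. Summing over all pairs avoids choosing a basis. -/
theorem eq_sum_rootElt (X : SoEven l) :
    X = ∑ p, ∑ q, ((1 / 2 : ℂ) * X.mat p q) • rootElt p q := by
  apply SoEven.mat_injective
  rw [← SoEven.matHom_apply, ← SoEven.matHom_apply, map_sum]
  simp only [map_sum, map_smul, SoEven.matHom_apply]
  ext r s
  simp only [Matrix.sum_apply, Matrix.smul_apply, rootElt_mat_apply, smul_eq_mul, mul_sub,
    Finset.sum_sub_distrib]
  have h1 : ∑ p, ∑ q, (1 / 2 : ℂ) * X.mat p q * (if r = p ∧ s = q then 1 else 0) =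
      1 / 2 * X.mat r s := by
    rw [Finset.sum_eq_single r, Finset.sum_eq_single s] <;> simp +contextual [eq_comm]
  have h2 : ∑ p, ∑ q, (1 / 2 : ℂ) * X.mat p q * (if r = q.swap ∧ s = p.swap then 1 else 0) =
      - (1 / 2 * X.mat r s) := by
    rw [Finset.sum_eq_single s.swap, Finset.sum_eq_single r.swap]
    · have := X.mat_swap_swap r s
      simp [this]
    · intro b _ hb
      rw [if_neg, mul_zero]
      rintro ⟨rfl, -⟩
      simp at hb
    · simp
    · intro b _ hb
      refine Finset.sum_eq_zero fun c _ => ?_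
      rw [if_neg, mul_zero]
      rintro ⟨-, rfl⟩
      simp at hb
    · simp
  rw [h1, h2]; ring

/-- Skew-adjointness of `X` makes the contribution of the second matrix unit follow the same pattern
as the first, so both reassemble into root elements. -/
theorem lie_rootElt (X : SoEven l) (p q : Fin l ⊕ Fin l) :
    ⁅X, rootElt p q⁆ = ∑ r, X.mat r p • rootElt r q - ∑ r, X.mat q r • rootElt p r := by
  apply SoEven.mat_injective
  rw [SoEven.mat_lie, ← SoEven.matHom_apply (_ - _), map_sub, map_sum, map_sum]
  simp only [map_smul, SoEven.matHom_apply]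
  ext a b
  simp only [Matrix.sub_apply, Matrix.sum_apply, Matrix.smul_apply, rootElt_mat_apply,
    smul_eq_mul, mul_sub, Finset.sum_sub_distrib, Matrix.mul_apply, sub_mul]
  have e : ∀ r a : Fin l ⊕ Fin l, (a = r.swap) = (r = a.swap) := fun r a =>
    propext ⟨fun h => by simp [h], fun h => by simp [h]⟩
  have h1 := X.mat_swap_swap q a.swap
  have h2 := X.mat_swap_swap b.swap p
  simp only [Sum.swap_swap] at h1 h2
  simp only [ite_and, mul_ite, ite_mul, mul_one, mul_zero, one_mul, zero_mul, e,
    Finset.sum_ite_eq, Finset.sum_ite_eq', Finset.mem_univ, if_true, Finset.sum_ite_irrel,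
    Finset.sum_const_zero, h1, h2]
  split_ifs <;> ring

theorem rootElt_lie_rootElt (a b p q : Fin l ⊕ Fin l) :
    ⁅rootElt a b, rootElt p q⁆ =
      (if b = p then rootElt a q else 0) - (if p = a.swap then rootElt b.swap q else 0)
      - (if q = a then rootElt p b else 0) + (if q = b.swap then rootElt p a.swap else 0) := by
  rw [lie_rootElt]
  simp only [rootElt_mat_apply, sub_smul, ite_smul, one_smul, zero_smul, Finset.sum_sub_distrib,
    ite_and, Finset.sum_ite_eq', Finset.mem_univ, if_true,
    Finset.sum_ite_irrel, Finset.sum_const_zero, eq_comm (a := p) (b := b)]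
  abel

/-- The coordinates of a weight of the natural module. -/
def signed (t : Fin l → ℂ) : Fin l ⊕ Fin l → ℂ := Sum.elim t (-t)

theorem cartan_mat (t : Fin l → ℂ) : (cartan t).mat = Matrix.diagonal (signed t) := rfl

theorem cartan_lie_rootElt (t : Fin l → ℂ) (p q : Fin l ⊕ Fin l) :
    ⁅cartan t, rootElt p q⁆ = (signed t p - signed t q) • rootElt p q := by
  rw [lie_rootElt]
  simp [cartan_mat, Matrix.diagonal_apply, ite_smul, sub_smul]

theorem cartan_eq_sum (t : Fin l → ℂ) :
    cartan t = ∑ i, t i • rootElt (Sum.inl i) (Sum.inl i) := by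
  apply SoEven.mat_injective
  rw [← SoEven.matHom_apply (∑ i, _), map_sum]
  simp only [map_smul, SoEven.matHom_apply]
  ext r s
  rcases r with r | r <;> rcases s with s | s <;>
    simp [Matrix.sum_apply, rootElt_mat_apply, cartan_mat, Matrix.diagonal_apply, signed, ite_and, eq_comm]
  split_ifs <;> simp

theorem rootElt_self_eq_cartan (i : Fin l) :
    rootElt (Sum.inl i) (Sum.inl i) = cartan (Pi.single i 1) := by
  rw [cartan_eq_sum]
  simp [Pi.single_apply, ite_smul]

end MatrixRealization

/-! ### The Killing form and its canonical tensor. -/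

section Killing

attribute [local instance] LieRing.ofAssociativeRing

variable {l : ℕ}

/-- A coordinate function, as a linear form. -/
noncomputable def coordForm (p q : Fin l ⊕ Fin l) : SoEven l →ₗ[ℂ] ℂ :=
  (Matrix.entryLinearMap ℂ ℂ p q).comp (SoEven.matHom l)

theorem coordForm_apply (p q : Fin l ⊕ Fin l) (X : SoEven l) : coordForm p q X = X.mat p q := rfl

/-- The doubled expansion of the identity is enough for traces: write `T` as a sum of rank-one
tensors and contract each of them. -/
theorem trace_end_eq_sum (T : Module.End ℂ (SoEven l)) :
    LinearMap.trace ℂ _ T = ∑ p, ∑ q, (1 / 2 : ℂ) * (T (rootElt p q)).mat p q := by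
  have h : T = ∑ p, ∑ q, dualTensorHom ℂ (SoEven l) (SoEven l)
      (((1 / 2 : ℂ) • coordForm p q) ⊗ₜ T (rootElt p q)) := by
    ext X
    conv_lhs => rw [eq_sum_rootElt X]
    simp [map_sum, LinearMap.sum_apply, coordForm_apply]
  conv_lhs => rw [h]
  simp only [map_sum, LinearMap.trace_eq_contract_apply, contractLeft_apply, LinearMap.smul_apply,
    coordForm_apply, smul_eq_mul]

theorem single_mul_mul_apply {n : Type*} [Fintype n] [DecidableEq n] (A B : Matrix n n ℂ)
    (p q r s : n) : (A * Matrix.single p q (1 : ℂ) * B : Matrix n n ℂ) r s = A r p * B q s := by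
  rw [Matrix.mul_apply, Finset.sum_eq_single q]
  · simp
  · intro b _ hb
    rw [Matrix.mul_single_apply_of_ne _ _ _ _ _ hb.symm.symm, zero_mul]
  · simp

theorem mat_mul_rootElt_mul (A B : Matrix (Fin l ⊕ Fin l) (Fin l ⊕ Fin l) ℂ)
    (p q : Fin l ⊕ Fin l) :
    (A * (rootElt p q).mat * B) p q = A p p * B q q - A p q.swap * B p.swap q := by
  rw [rootElt_mat, mul_sub, sub_mul, Matrix.sub_apply, single_mul_mul_apply, single_mul_mul_apply]

theorem sum_swap {α : Type*} [AddCommMonoid α] (f : Fin l ⊕ Fin l → α) :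
    ∑ p : Fin l ⊕ Fin l, f p.swap = ∑ p, f p := by
  simp [Fintype.sum_sum_type, add_comm]

theorem SoEven.trace_mat (X : SoEven l) : X.mat.trace = 0 := by
  have h : ∑ p : Fin l ⊕ Fin l, X.mat p.swap p.swap = ∑ p, X.mat p p := sum_swap fun p => X.mat p p
  simp only [SoEven.mat_swap_swap, Finset.sum_neg_distrib] at h
  have h2 : (2 : ℂ) * ∑ p, X.mat p p = 0 := by linear_combination -h
  simpa [Matrix.trace, Matrix.diag] using h2

/-- `ad X ad Y` sends `Z` to `XYZ - XZY - YZX + ZYX`. In the doubled trace the outer terms each give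
`2l - 1` times `tr(XY)` and the inner ones `-1` each; halving `4l - 4` gives the constant. -/
theorem killingForm_eq (X Y : SoEven l) :
    killingForm ℂ (SoEven l) X Y = (2 * l - 2 : ℂ) * (X.mat * Y.mat).trace := by
  rw [killingForm_apply_apply, trace_end_eq_sum]
  have hc : (∑ _p : Fin l ⊕ Fin l, (1 : ℂ)) = 2 * l := by simp [two_mul]
  have h : ∀ p q, (((LieAlgebra.ad ℂ (SoEven l) X ∘ₗ LieAlgebra.ad ℂ (SoEven l) Y))
      (rootElt p q)).mat p q =
      ((X.mat * Y.mat) p p - (X.mat * Y.mat) p q.swap * (if p.swap = q then 1 else 0))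
      - (X.mat p p * Y.mat q q - X.mat p q.swap * Y.mat p.swap q)
      - (Y.mat p p * X.mat q q - Y.mat p q.swap * X.mat p.swap q)
      + ((Y.mat * X.mat) q q - (if p = q.swap then 1 else 0) * (Y.mat * X.mat) p.swap q) := by
    intro p q
    have e : (((LieAlgebra.ad ℂ (SoEven l) X ∘ₗ LieAlgebra.ad ℂ (SoEven l) Y))
        (rootElt p q)).mat = (X.mat * Y.mat) * (rootElt p q).mat * 1
          - X.mat * (rootElt p q).mat * Y.mat - Y.mat * (rootElt p q).mat * X.mat
          + 1 * (rootElt p q).mat * (Y.mat * X.mat) := by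
      change X.mat * (Y.mat * (rootElt p q).mat - (rootElt p q).mat * Y.mat)
        - (Y.mat * (rootElt p q).mat - (rootElt p q).mat * Y.mat) * X.mat = _
      noncomm_ring
    rw [e, Matrix.add_apply, Matrix.sub_apply, Matrix.sub_apply, mat_mul_rootElt_mul,
      mat_mul_rootElt_mul, mat_mul_rootElt_mul, mat_mul_rootElt_mul]
    simp [Matrix.one_apply]
  simp only [h]
  have hX := X.trace_mat
  have hY := Y.trace_mat
  have hYX : (Y.mat * X.mat).trace = (X.mat * Y.mat).trace := Matrix.trace_mul_comm _ _
  have k1 : ∀ A B : SoEven l, ∑ p, ∑ q, A.mat p q.swap * B.mat p.swap q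
      = - (A.mat * B.mat).trace := by
    intro A B
    simp only [Matrix.trace, Matrix.diag, Matrix.mul_apply, ← Finset.sum_neg_distrib]
    refine Finset.sum_congr rfl fun p _ => ?_
    rw [← sum_swap]
    refine Finset.sum_congr rfl fun q _ => ?_
    rw [B.mat_swap_swap]
    simp
  have k2 : ∑ p, ∑ q, (X.mat * Y.mat) p q.swap * (if p.swap = q then 1 else 0)
      = (X.mat * Y.mat).trace := by
    simp [Matrix.trace]
  have k3 : ∑ p, ∑ q : Fin l ⊕ Fin l, (if p = q.swap then 1 else 0) * (Y.mat * X.mat) p.swap q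
      = (X.mat * Y.mat).trace := by
    rw [← hYX, Finset.sum_comm]
    simp [Matrix.trace]
  have k4 : ∀ A B : SoEven l, ∑ p, ∑ q, A.mat p p * B.mat q q = 0 := by
    intro A B
    rw [← Finset.sum_mul_sum]
    have := A.trace_mat
    simp only [Matrix.trace, Matrix.diag] at this
    rw [this, zero_mul]
  have k5 : ∑ p, ∑ _q : Fin l ⊕ Fin l, (X.mat * Y.mat) p p = 2 * l * (X.mat * Y.mat).trace := by
    rw [Finset.sum_comm, Finset.sum_const, ← hc]
    simp [Matrix.trace, mul_add]
  have k6 : ∑ _p : Fin l ⊕ Fin l, ∑ q, (Y.mat * X.mat) q q = 2 * l * (X.mat * Y.mat).trace := by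
    rw [Finset.sum_const, ← hc, ← hYX]
    simp [Matrix.trace, mul_add]
  have k : ∀ f : Fin l ⊕ Fin l → Fin l ⊕ Fin l → ℂ,
      ∑ p, ∑ q, (1 / 2 : ℂ) * f p q = 1 / 2 * ∑ p, ∑ q, f p q := by
    intro f
    simp only [Finset.mul_sum]
  rw [k]
  simp only [Finset.sum_add_distrib, Finset.sum_sub_distrib, k1, k2, k3, k4, k5, k6, hYX]
  ring

theorem trace_rootElt_mul (p q : Fin l ⊕ Fin l) (X : SoEven l) :
    ((rootElt q p).mat * X.mat).trace = 2 * X.mat p q := by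
  rw [rootElt_mat, sub_mul, Matrix.trace_sub, Matrix.trace_single_mul, Matrix.trace_single_mul,
    X.mat_swap_swap]
  simp; ring

/-- The invariant tensor of the trace form, contracted with a bilinear map. -/
noncomputable def contractCasimir {A : Type*} [AddCommGroup A] [Module ℂ A]
    (φ : SoEven l →ₗ[ℂ] SoEven l →ₗ[ℂ] A) : A :=
  ∑ p, ∑ q, φ (rootElt p q) (rootElt q p)

/-- The left side is the canonical tensor of the Killing form contracted with `φ`, so any expansion
of the identity computes it. The constant 4 is one factor 2 from the doubled family and one from
`trace_rootElt_mul`. -/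
theorem sum_dualBasis_eq (hl : 2 ≤ l) {m : ℕ} (x : Module.Basis (Fin m) ℂ (SoEven l))
    {A : Type*} [AddCommGroup A] [Module ℂ A] (φ : SoEven l →ₗ[ℂ] SoEven l →ₗ[ℂ] A) :
    ∑ i, φ (x i) (LinearMap.BilinForm.dualBasis (killingForm ℂ (SoEven l))
      (killingForm_nondegenerate hl) x i) =
    (4 * (2 * l - 2) : ℂ)⁻¹ • contractCasimir φ := by
  have hl0 : (2 * l - 2 : ℂ) ≠ 0 := by
    intro h
    have h1 : (l : ℂ) = 1 := by linear_combination h / 2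
    have : l = 1 := by exact_mod_cast h1
    omega
  set y := LinearMap.BilinForm.dualBasis (killingForm ℂ (SoEven l))
      (killingForm_nondegenerate hl) x with hy
  -- Expanding `z` in the dual basis lets the sum over `i` collapse at the end, leaving only root
  -- elements.
  have key : ∀ z, ∑ i, killingForm ℂ (SoEven l) z (x i) • y i = z := by
    intro z
    conv_rhs => rw [← y.sum_repr z]
    simp [hy, LinearMap.BilinForm.dualBasis_repr_apply]
  have hx : ∀ X : SoEven l, X = ∑ p, ∑ q, ((4 * (2 * l - 2) : ℂ)⁻¹ *
      killingForm ℂ (SoEven l) (rootElt q p) X) • rootElt p q := by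
    intro X
    conv_lhs => rw [eq_sum_rootElt X]
    refine Finset.sum_congr rfl fun p _ => Finset.sum_congr rfl fun q _ => ?_
    rw [killingForm_eq, trace_rootElt_mul]
    congr 1
    rw [mul_inv]
    linear_combination (- X.mat p q / 2) * inv_mul_cancel₀ hl0
  calc ∑ i, φ (x i) (y i)
      = ∑ i, ∑ p, ∑ q, (4 * (2 * l - 2) : ℂ)⁻¹ •
        φ (rootElt p q) (killingForm ℂ (SoEven l) (rootElt q p) (x i) • y i) := by
        refine Finset.sum_congr rfl fun i _ => ?_
        conv_lhs => rw [hx (x i)]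
        simp only [map_sum, LinearMap.sum_apply, map_smul, LinearMap.smul_apply, smul_smul]
    _ = (4 * (2 * l - 2) : ℂ)⁻¹ • contractCasimir φ := by
        rw [Finset.sum_comm, contractCasimir, Finset.smul_sum]
        refine Finset.sum_congr rfl fun p _ => ?_
        rw [Finset.sum_comm, Finset.smul_sum]
        refine Finset.sum_congr rfl fun q _ => ?_
        rw [← Finset.smul_sum, ← map_sum, key]

end Killing

/-! ### Positive roots, ρ, and positivity of weights. -/

section RootOrder

variable {l : ℕ}

/-- The ordering of the basis of the natural module in which the Borel subalgebra is upper
triangular. -/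
def Raises : Fin l ⊕ Fin l → Fin l ⊕ Fin l → Prop
  | Sum.inl i, Sum.inl j => i < j
  | Sum.inl _, Sum.inr _ => True
  | Sum.inr _, Sum.inl _ => False
  | Sum.inr i, Sum.inr j => j < i

theorem raises_trichotomy (p q : Fin l ⊕ Fin l) : Raises p q ∨ p = q ∨ Raises q p := by
  rcases p with i | i <;> rcases q with j | j <;> simp [Raises] <;> omega

theorem IsPositive.mat_eq_zero {X : SoEven l} (hX : IsPositive X) {p q : Fin l ⊕ Fin l}
    (h : ¬ Raises p q) : X.mat p q = 0 := by
  rcases p with i | i <;> rcases q with j | j <;> simp [Raises] at h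
  · exact hX.1 i j h
  · exact hX.2 i j
  · have := X.mat_swap_swap (Sum.inr i) (Sum.inr j)
    rw [Sum.swap_inr, Sum.swap_inr, hX.1 j i h] at this
    exact neg_eq_zero.mp this.symm

theorem isPositive_rootElt {p q : Fin l ⊕ Fin l} (h : Raises p q) : IsPositive (rootElt p q) := by
  constructor
  · intro i j hij
    rw [rootElt_mat_apply]
    rcases p with a | a <;> rcases q with b | b <;> simp [Raises] at h ⊢
    all_goals
      rintro rfl rfl
      omega
  · intro i j
    rw [rootElt_mat_apply]
    rcases p with a | a <;> rcases q with b | b <;> simp [Raises] at h ⊢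

/-- The weights of the natural module. -/
def natWeight : Fin l ⊕ Fin l → Fin l → ℂ :=
  Sum.elim (fun i => Pi.single i 1) (fun i => - Pi.single i 1)

theorem evalWeight_add (x y t : Fin l → ℂ) :
    evalWeight (x + y) t = evalWeight x t + evalWeight y t := by
  simp [evalWeight, add_mul, Finset.sum_add_distrib]

theorem evalWeight_sub (x y t : Fin l → ℂ) :
    evalWeight (x - y) t = evalWeight x t - evalWeight y t := by
  simp [evalWeight, sub_mul, Finset.sum_sub_distrib]

theorem evalWeight_smul (c : ℂ) (y t : Fin l → ℂ) :
    evalWeight (c • y) t = c * evalWeight y t := by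
  simp [evalWeight, mul_assoc, Finset.mul_sum]

theorem evalWeight_comm (x y : Fin l → ℂ) : evalWeight x y = evalWeight y x := by
  simp [evalWeight, mul_comm]

theorem evalWeight_single (x : Fin l → ℂ) (i : Fin l) : evalWeight x (Pi.single i 1) = x i := by
  simp [evalWeight, Pi.single_apply]

theorem evalWeight_natWeight (p : Fin l ⊕ Fin l) (t : Fin l → ℂ) :
    evalWeight (natWeight p) t = signed t p := by
  rcases p with p | p <;> simp [evalWeight, natWeight, signed, Pi.single_apply]

/-- The half sum of the positive roots. -/
noncomputable def rho (l : ℕ) : Fin l → ℂ := fun i => (l : ℂ) - 1 - i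

/-- Strictly dominant real parts. -/
def IsRegularDominant (x : Fin l → ℂ) : Prop :=
  ∀ p q : Fin l ⊕ Fin l, Raises p q → p ≠ q.swap → 0 < (signed x p - signed x q).re

theorem isRegularDominant_rho : IsRegularDominant (rho l) := by
  intro p q h hpq
  rcases p with i | i <;> rcases q with j | j <;> simp [Raises] at h hpq <;>
    simp [signed, rho]
  · exact h
  · have h1 : i.val < l := i.2
    have h2 : j.val < l := j.2
    have h3 : i.val ≠ j.val := fun h => hpq (Fin.ext h)
    have h4 : (i.val : ℝ) + j.val + 2 < l + l := by
      have : i.val + j.val + 2 < l + l := by omega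
      exact_mod_cast this
    linarith
  · exact h

/-- A weight that pairs positively with every strictly dominant weight. -/
def IsPositiveWeight (k : Fin l → ℂ) : Prop :=
  ∀ x, IsRegularDominant x → 0 < (evalWeight k x).re

theorem isPositiveWeight_root {p q : Fin l ⊕ Fin l} (h : Raises p q) (hpq : p ≠ q.swap) :
    IsPositiveWeight (natWeight p - natWeight q) := by
  intro x hx
  rw [evalWeight_sub, evalWeight_natWeight, evalWeight_natWeight]
  exact hx p q h hpq

theorem IsPositiveWeight.add {k k' : Fin l → ℂ} (h : IsPositiveWeight k)
    (h' : IsPositiveWeight k') : IsPositiveWeight (k + k') := by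
  intro x hx
  rw [evalWeight_add, Complex.add_re]
  exact add_pos (h x hx) (h' x hx)

theorem IsPositiveWeight.ne_zero {k : Fin l → ℂ} (h : IsPositiveWeight k) : k ≠ 0 := by
  rintro rfl
  have := h (rho l) isRegularDominant_rho
  simp [evalWeight] at this

end RootOrder

/-! ### Weight vectors and the sl₂-triples of the roots. -/

section HighestWeight

variable {l : ℕ} {U : Type*} [AddCommGroup U] [Module ℂ U] [LieRingModule (SoEven l) U]
  [LieModule ℂ (SoEven l) U]

/-- A (nonzero) highest weight vector. -/
def IsHighestWeightVector (lam : Fin l → ℂ) (v : U) : Prop :=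
  IsWeightVector lam v ∧ ∀ X : SoEven l, IsPositive X → ⁅X, v⁆ = 0

theorem lie_eq_sum_rootElt (X : SoEven l) (u : U) :
    ⁅X, u⁆ = ∑ p, ∑ q, ((1 / 2 : ℂ) * X.mat p q) • ⁅rootElt p q, u⁆ := by
  conv_lhs => rw [eq_sum_rootElt X]
  simp only [sum_lie, smul_lie]

theorem lie_eq_zero_of_isPositive {u : U} (h : ∀ p q : Fin l ⊕ Fin l, Raises p q → ⁅rootElt p q, u⁆ = 0)
    {X : SoEven l} (hX : IsPositive X) : ⁅X, u⁆ = 0 := by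
  rw [lie_eq_sum_rootElt]
  refine Finset.sum_eq_zero fun p _ => Finset.sum_eq_zero fun q _ => ?_
  by_cases hpq : Raises p q
  · rw [h p q hpq, smul_zero]
  · rw [hX.mat_eq_zero hpq, mul_zero, zero_smul]

variable (U) in
/-- The weight spaces. -/
def weightSpace (lam : Fin l → ℂ) : Submodule ℂ U where
  carrier := {u | ∀ t : Fin l → ℂ, ⁅(cartan t : SoEven l), u⁆ = evalWeight lam t • u}
  add_mem' ha hb t := by simp [ha t, hb t]
  zero_mem' t := by simp
  smul_mem' c u hu t := by rw [lie_smul, hu t, smul_comm]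

theorem rootElt_lie_mem_weightSpace {lam : Fin l → ℂ} {u : U} (hu : u ∈ weightSpace U lam)
    (p q : Fin l ⊕ Fin l) :
    ⁅rootElt p q, u⁆ ∈ weightSpace U (lam + (natWeight p - natWeight q)) := by
  intro t
  rw [leibniz_lie, cartan_lie_rootElt, smul_lie, hu t, lie_smul, ← add_smul, evalWeight_add,
    evalWeight_sub, evalWeight_natWeight, evalWeight_natWeight, add_comm]

theorem rootElt_self_lie {lam : Fin l → ℂ} {u : U} (hu : u ∈ weightSpace U lam)
    (p : Fin l ⊕ Fin l) : ⁅rootElt p p, u⁆ = signed lam p • u := by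
  have h : ∀ i : Fin l, ⁅rootElt (Sum.inl i) (Sum.inl i), u⁆ = lam i • u := by
    intro i
    rw [rootElt_self_eq_cartan, hu, evalWeight_single]
  rcases p with i | i
  · exact h i
  · have := rootElt_swap (Sum.inl i) (Sum.inl i)
    simp only [Sum.swap_inl] at this
    rw [this, neg_lie, h, signed, Sum.elim_inr, Pi.neg_apply, neg_smul]

theorem rootElt_lie_rootElt_opp {p q : Fin l ⊕ Fin l} (hpq : p ≠ q) (hpq' : p ≠ q.swap) :
    ⁅rootElt p q, rootElt q p⁆ = rootElt p p - rootElt q q := by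
  have : q ≠ p.swap := by rintro rfl; simp at hpq'
  rw [rootElt_lie_rootElt]
  simp [hpq', this]

theorem rootElt_lie_rootElt_lie {lam : Fin l → ℂ} {u : U} (hu : u ∈ weightSpace U lam)
    {p q : Fin l ⊕ Fin l} (hpq : p ≠ q) (hpq' : p ≠ q.swap) (h : ⁅rootElt p q, u⁆ = 0) :
    ⁅rootElt p q, ⁅rootElt q p, u⁆⁆ = (signed lam p - signed lam q) • u := by
  rw [leibniz_lie, h, lie_zero, add_zero, rootElt_lie_rootElt_opp hpq hpq', sub_lie,
    rootElt_self_lie hu, rootElt_self_lie hu, sub_smul]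

theorem isSl2Triple_rootElt {p q : Fin l ⊕ Fin l} (hpq : p ≠ q) (hpq' : p ≠ q.swap) :
    IsSl2Triple (rootElt p p - rootElt q q) (rootElt p q) (rootElt q p) := by
  have h1 : q ≠ p.swap := by rintro rfl; simp at hpq'
  have h2 : ∀ r : Fin l ⊕ Fin l, r ≠ r.swap := by rintro (r | r) <;> simp
  refine ⟨?_, rootElt_lie_rootElt_opp hpq hpq', ?_, ?_⟩
  · intro h
    have := congrArg (fun X : SoEven l => SoEven.matHom l X p p) h
    simp only [map_sub, SoEven.matHom_apply, map_zero, Matrix.sub_apply, Matrix.zero_apply,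
      rootElt_mat_apply] at this
    simp [hpq, hpq', h2] at this
  · rw [sub_lie, rootElt_lie_rootElt, rootElt_lie_rootElt]
    simp [hpq.symm, hpq', h1, h2, two_smul]
  · rw [sub_lie, rootElt_lie_rootElt, rootElt_lie_rootElt]
    simp [hpq, hpq', h1, h2, two_smul]
    abel

theorem IsHighestWeightVector.primitive {lam : Fin l → ℂ} {v : U}
    (hv : IsHighestWeightVector lam v) {p q : Fin l ⊕ Fin l} (h : Raises p q) (hpq : p ≠ q)
    (hpq' : p ≠ q.swap) : (isSl2Triple_rootElt hpq hpq').HasPrimitiveVectorWith v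
      (signed lam p - signed lam q) where
  ne_zero := hv.1.1
  lie_h := by rw [sub_lie, rootElt_self_lie hv.1.2, rootElt_self_lie hv.1.2, sub_smul]
  lie_e := hv.2 _ (isPositive_rootElt h)

theorem Raises.ne {p q : Fin l ⊕ Fin l} (h : Raises p q) : p ≠ q := by
  rintro rfl
  rcases p with p | p <;> simp [Raises] at h

/-- The vector is primitive for the sl₂-triple of this positive root, and finite dimension forces
its sl₂-weight to be a natural number. -/
theorem IsHighestWeightVector.exists_nat [FiniteDimensional ℂ U] {lam : Fin l → ℂ} {v : U}
    (hv : IsHighestWeightVector lam v) {p q : Fin l ⊕ Fin l} (h : Raises p q)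
    (hpq' : p ≠ q.swap) : ∃ n : ℕ, signed lam p - signed lam q = n :=
  (hv.primitive h h.ne hpq').exists_nat

/-- Weights of highest weight vectors in finite-dimensional modules are dominant. -/
theorem IsHighestWeightVector.isRegularDominant_add [FiniteDimensional ℂ U] {lam mu : Fin l → ℂ}
    {v w : U} (hv : IsHighestWeightVector lam v) (hw : IsHighestWeightVector mu w) :
    IsRegularDominant (lam + mu + (2 : ℂ) • rho l) := by
  intro p q h hpq
  obtain ⟨n, hn⟩ := hv.exists_nat h hpq
  obtain ⟨m, hm⟩ := hw.exists_nat h hpq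
  have hr := isRegularDominant_rho p q h hpq
  have e : ∀ r, signed (lam + mu + (2 : ℂ) • rho l) r =
      signed lam r + signed mu r + 2 * signed (rho l) r := by
    rintro (r | r) <;> simp [signed]; ring
  have : signed (lam + mu + (2 : ℂ) • rho l) p - signed (lam + mu + (2 : ℂ) • rho l) q =
      n + m + 2 * (signed (rho l) p - signed (rho l) q) := by
    rw [e, e, ← hn, ← hm]; ring
  rw [this]
  have h2 : (2 * (signed (rho l) p - signed (rho l) q)).re =
      2 * (signed (rho l) p - signed (rho l) q).re := by simp
  rw [Complex.add_re, Complex.add_re, h2, Complex.natCast_re, Complex.natCast_re]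
  positivity

end HighestWeight

/-! ### The Casimir operator: centrality and its value on highest weight vectors. -/

section Casimir

variable {l : ℕ} (U : Type*) [AddCommGroup U] [Module ℂ U] [LieRingModule (SoEven l) U]
  [LieModule ℂ (SoEven l) U]

/-- The Casimir operator, up to normalization. -/
noncomputable def casimir : Module.End ℂ U :=
  ∑ p, ∑ q, LieModule.toEnd ℂ (SoEven l) U (rootElt p q) *
    LieModule.toEnd ℂ (SoEven l) U (rootElt q p)

variable {U}

theorem casimir_apply (u : U) :
    casimir (l := l) U u = ∑ p, ∑ q, ⁅rootElt (l := l) p q, ⁅rootElt q p, u⁆⁆ := by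
  simp [casimir, LinearMap.sum_apply]

/-- The derivation rule produces four triple sums. After exchanging `p` with `r` in the first and
`q` with `r` in the second, they cancel the fourth and the third. -/
theorem lie_casimir (X : SoEven l) (u : U) :
    ⁅X, casimir (l := l) U u⁆ = casimir (l := l) U ⁅X, u⁆ := by
  have h : ∀ p q : Fin l ⊕ Fin l, ⁅X, ⁅rootElt p q, ⁅rootElt q p, u⁆⁆⁆ =
      (∑ r, X.mat r p • ⁅rootElt r q, ⁅rootElt q p, u⁆⁆
        - ∑ r, X.mat q r • ⁅rootElt p r, ⁅rootElt q p, u⁆⁆)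
      + (∑ r, X.mat r q • ⁅rootElt p q, ⁅rootElt r p, u⁆⁆
        - ∑ r, X.mat p r • ⁅rootElt p q, ⁅rootElt q r, u⁆⁆)
      + ⁅rootElt p q, ⁅rootElt q p, ⁅X, u⁆⁆⁆ := by
    intro p q
    rw [leibniz_lie X, leibniz_lie X (rootElt q p), lie_add, lie_rootElt, lie_rootElt, sub_lie,
      sub_lie, lie_sub, sum_lie]
    simp only [sum_lie, lie_sum, smul_lie, lie_smul]
    abel
  have c3 : ∀ f : Fin l ⊕ Fin l → Fin l ⊕ Fin l → Fin l ⊕ Fin l → U,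
      ∑ p, ∑ q, ∑ r, f p q r = ∑ p, ∑ q, ∑ r, f r q p := by
    intro f
    calc ∑ p, ∑ q, ∑ r, f p q r = ∑ q, ∑ p, ∑ r, f p q r := Finset.sum_comm
      _ = ∑ q, ∑ r, ∑ p, f p q r := Finset.sum_congr rfl fun _ _ => Finset.sum_comm
      _ = ∑ r, ∑ q, ∑ p, f p q r := Finset.sum_comm
  have c2 : ∀ f : Fin l ⊕ Fin l → Fin l ⊕ Fin l → Fin l ⊕ Fin l → U,
      ∑ p, ∑ q, ∑ r, f p q r = ∑ p, ∑ q, ∑ r, f p r q := fun f =>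
    Finset.sum_congr rfl fun _ _ => Finset.sum_comm
  simp only [casimir_apply, lie_sum, h, Finset.sum_add_distrib, Finset.sum_sub_distrib]
  rw [c3 fun p q r => X.mat r p • ⁅rootElt r q, ⁅rootElt q p, u⁆⁆,
    c2 fun p q r => X.mat q r • ⁅rootElt p r, ⁅rootElt q p, u⁆⁆]
  abel

/-- Pairs ending in a raising operator kill `v`, and a raising operator after its opposite acts by a
coroot value. The diagonal pairs add up to `2(λ, λ)`; each positive root occurs in two pairs, which
gives `4(λ, ρ)`. -/
theorem casimir_lie_eq_smul {lam : Fin l → ℂ} {v : U} (hv : IsHighestWeightVector lam v) :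
    casimir (l := l) U v = (2 * evalWeight lam (lam + (2 : ℂ) • rho l)) • v := by
  classical
  obtain ⟨R, hR⟩ : ∃ R : Fin l ⊕ Fin l → Fin l ⊕ Fin l → ℂ, ∀ p q, R p q =
      if Raises p q ∧ p ≠ q.swap then signed lam p - signed lam q else 0 := ⟨_, fun _ _ => rfl⟩
  have key : ∀ p q : Fin l ⊕ Fin l, ⁅rootElt p q, ⁅rootElt q p, v⁆⁆ =
      ((if p = q then signed lam p ^ 2 else 0) + R p q) • v := by
    intro p q
    rw [hR]
    rcases raises_trichotomy p q with h | rfl | h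
    · by_cases hpq : p = q.swap
      · have : rootElt q p = 0 := by rw [hpq]; exact rootElt_self_swap q
        rw [this, zero_lie, lie_zero]
        simp [hpq, (hpq ▸ h : Raises q.swap q).ne]
      · rw [rootElt_lie_rootElt_lie hv.1.2 h.ne hpq (hv.2 _ (isPositive_rootElt h))]
        simp [h, h.ne, hpq]
    · have hp : ¬ Raises p p := fun h => h.ne rfl
      rw [rootElt_self_lie hv.1.2, lie_smul, rootElt_self_lie hv.1.2, smul_smul]
      simp [hp, pow_two]
    · have hn : ¬ Raises p q := by
        intro h'
        rcases p with p | p <;> rcases q with q | q <;> simp [Raises] at h h' <;> omega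
      rw [hv.2 _ (isPositive_rootElt h), lie_zero]
      simp [hn, h.ne.symm]
  rw [casimir_apply]
  simp only [key, ← Finset.sum_smul]
  congr 1
  -- The coordinate of ρ at `i` counts the indices above `i`: for each such `j`, the roots `μ_i -
  -- μ_j` and `μ_i + μ_j` together contribute `2 λ_i`.
  have hcard : ∀ i : Fin l, (∑ j : Fin l, if i < j then (1 : ℂ) else 0) = rho l i := by
    intro i
    have hi : (Finset.Ioi i).card = l - 1 - i := Fin.card_Ioi i
    have hi2 := i.2
    rw [Finset.sum_boole, rho, Finset.filter_lt_eq_Ioi, hi, Nat.sub_sub, Nat.cast_sub (by omega)]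
    push_cast; ring
  have s1 : ∑ i : Fin l, ∑ j : Fin l, (if i < j then lam i else 0) = ∑ i, lam i * rho l i := by
    simp_rw [← hcard, Finset.mul_sum, mul_ite, mul_one, mul_zero]
  have s2 : ∑ i : Fin l, ∑ j : Fin l, (if i < j then (lam i - lam j) else 0) =
      ∑ i : Fin l, ∑ j : Fin l, (if j < i then (lam j - lam i) else 0) := Finset.sum_comm
  have s3 : ∑ i : Fin l, ∑ j : Fin l, (if i ≠ j then (lam i + lam j) else 0) =
      2 * ∑ i : Fin l, ∑ j : Fin l, (if i < j then (lam i + lam j) else 0) := by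
    have e : ∀ i j : Fin l, (if i ≠ j then (lam i + lam j) else 0) =
        (if i < j then (lam i + lam j) else 0) + (if j < i then (lam j + lam i) else 0) := by
      intro i j
      rcases lt_trichotomy i j with h | h | h
      · simp [h, h.ne, h.not_gt]
      · simp [h]
      · simp [h, h.ne', h.not_gt, add_comm]
    simp only [e, Finset.sum_add_distrib]
    rw [two_mul]
    congr 1
    exact Finset.sum_comm
  have s4 : ∑ i : Fin l, ∑ j : Fin l, (if i < j then (lam i - lam j) else 0) +
      ∑ i : Fin l, ∑ j : Fin l, (if i < j then (lam i + lam j) else 0) =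
      2 * ∑ i, lam i * rho l i := by
    rw [← s1]
    simp only [← Finset.sum_add_distrib, Finset.mul_sum]
    refine Finset.sum_congr rfl fun i _ => Finset.sum_congr rfl fun j _ => ?_
    split_ifs <;> ring
  have s5 : evalWeight lam (lam + (2 : ℂ) • rho l) =
      ∑ i, lam i ^ 2 + 2 * ∑ i, lam i * rho l i := by
    rw [evalWeight_comm, evalWeight_add, evalWeight_smul, evalWeight_comm (rho l)]
    simp [evalWeight, pow_two]
  have d1 : ∀ i j : Fin l, R (Sum.inl i) (Sum.inl j) = if i < j then lam i - lam j else 0 := by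
    intro i j; simp [hR, Raises, signed]
  have d2 : ∀ i j : Fin l, R (Sum.inr i) (Sum.inr j) = if j < i then lam j - lam i else 0 := by
    intro i j; simp [hR, Raises, signed, add_comm, sub_eq_add_neg]
  have d3 : ∀ i j : Fin l, R (Sum.inl i) (Sum.inr j) = if i ≠ j then lam i + lam j else 0 := by
    intro i j; simp [hR, Raises, signed]
  have d4 : ∀ i j : Fin l, R (Sum.inr i) (Sum.inl j) = 0 := by
    intro i j; simp [hR, Raises]
  have d5 : ∑ p : Fin l ⊕ Fin l, ∑ q, (if p = q then signed lam p ^ 2 else 0) =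
      2 * ∑ i, lam i ^ 2 := by
    simp [signed, two_mul]
  simp only [Finset.sum_add_distrib, d5]
  simp only [Fintype.sum_sum_type, Finset.sum_add_distrib, d1, d2, d3, d4, ← s2, s3, s5,
    Finset.sum_const_zero]
  linear_combination 2 * s4

end Casimir

/-! ### Common eigenvectors of commuting operators. -/

section Eigenvectors

/-- Commuting operators on a finite-dimensional complex space have a common eigenvector in every
nonzero invariant subspace. -/
theorem exists_common_eigenvector {ι U : Type*} [Finite ι] [AddCommGroup U] [Module ℂ U]
    [FiniteDimensional ℂ U] (f : ι → Module.End ℂ U) (hf : ∀ i j, Commute (f i) (f j))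
    (E : Submodule ℂ U) (hE : E ≠ ⊥) (hfE : ∀ i, ∀ x ∈ E, f i x ∈ E) :
    ∃ (χ : ι → ℂ) (u : U), u ∈ E ∧ u ≠ 0 ∧ ∀ i, f i u = χ i • u := by
  classical
  have := Fintype.ofFinite ι
  suffices h : ∀ s : Finset ι, ∃ (χ : ι → ℂ) (u : U), u ∈ E ∧ u ≠ 0 ∧
      ∀ i ∈ s, f i u = χ i • u by
    obtain ⟨χ, u, h1, h2, h3⟩ := h Finset.univ
    exact ⟨χ, u, h1, h2, fun i => h3 i (Finset.mem_univ i)⟩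
  intro s
  induction s using Finset.induction_on with
  | empty =>
    obtain ⟨u, h1, h2⟩ := E.ne_bot_iff.mp hE
    exact ⟨0, u, h1, h2, by simp⟩
  | insert a s ha ih =>
    obtain ⟨χ, u, h1, h2, h3⟩ := ih
    -- The vectors of `E` that are already joint eigenvectors for `s`. Commutation makes this space
    -- stable under `f a`, so an eigenvector of `f a` can be found inside it.
    let F : Submodule ℂ U := E ⊓ ⨅ i ∈ s, (f i).eigenspace (χ i)
    have hF : ∀ x, x ∈ F ↔ x ∈ E ∧ ∀ i ∈ s, f i x = χ i • x := by
      intro x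
      simp [F, Submodule.mem_iInf]
    have hfF : ∀ x ∈ F, f a x ∈ F := by
      intro x hx
      rw [hF] at hx ⊢
      refine ⟨hfE a x hx.1, fun i hi => ?_⟩
      have := LinearMap.congr_fun (hf i a).eq x
      simp only [Module.End.mul_apply] at this
      rw [this, hx.2 i hi, map_smul]
    have : Nontrivial F := ⟨⟨⟨u, (hF u).mpr ⟨h1, h3⟩⟩, 0, by simpa [Subtype.ext_iff] using h2⟩⟩
    obtain ⟨c, hc⟩ := Module.End.exists_eigenvalue ((f a).restrict hfF)
    obtain ⟨w, hw⟩ := hc.exists_hasEigenvector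
    have hw1 := hw.apply_eq_smul
    have hw2 := (hF w.1).mp w.2
    refine ⟨Function.update χ a c, w.1, hw2.1, fun h => hw.2 (Subtype.ext h), ?_⟩
    intro i hi
    by_cases hia : i = a
    · subst hia
      simpa [Subtype.ext_iff] using hw1
    · rw [Function.update_of_ne hia]
      exact hw2.2 i ((Finset.mem_insert.mp hi).resolve_left hia)

end Eigenvectors

/-! ### Highest weight vectors exist and generate irreducible modules. -/

section HighestWeight

variable {l : ℕ} {U : Type*} [AddCommGroup U] [Module ℂ U] [LieRingModule (SoEven l) U]
  [LieModule ℂ (SoEven l) U]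

theorem mem_weightSpace_of_coord {lam : Fin l → ℂ} {u : U}
    (h : ∀ i, ⁅(cartan (Pi.single i 1) : SoEven l), u⁆ = lam i • u) : u ∈ weightSpace U lam := by
  intro t
  rw [cartan_eq_sum, sum_lie, evalWeight, Finset.sum_smul]
  refine Finset.sum_congr rfl fun i _ => ?_
  rw [smul_lie, rootElt_self_eq_cartan, h, smul_smul, mul_comm]

theorem cartan_lie_cartan (t t' : Fin l → ℂ) : ⁅cartan t, cartan t'⁆ = 0 := by
  rw [cartan_eq_sum t', lie_sum]
  refine Finset.sum_eq_zero fun i _ => ?_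
  rw [lie_smul, cartan_lie_rootElt, sub_self, zero_smul, smul_zero]

theorem commute_toEnd_cartan (t t' : Fin l → ℂ) :
    Commute (LieModule.toEnd ℂ (SoEven l) U (cartan t))
      (LieModule.toEnd ℂ (SoEven l) U (cartan t')) := by
  ext u
  have := leibniz_lie (cartan t) (cartan t') u
  rwa [cartan_lie_cartan, zero_lie, zero_add] at this

theorem exists_grading (l : ℕ) : ∃ t : Fin l → ℂ, ∀ p q : Fin l ⊕ Fin l, Raises p q →
    0 < (signed t p - signed t q).re := by
  -- Unlike those of ρ, these coordinates are all positive, so the difference is positive even for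
  -- the pairs `(i, i')`, which carry no root.
  refine ⟨fun i => (l : ℂ) - i, fun p q h => ?_⟩
  rcases p with i | i <;> rcases q with j | j <;> simp [Raises] at h <;> simp [signed]
  · exact h
  · have h1 : (i.val : ℝ) < l := by exact_mod_cast i.2
    have h2 : (j.val : ℝ) < l := by exact_mod_cast j.2
    linarith
  · exact h

/-- Choose an eigenvalue of a grading element with maximal real part. Raising operators would
increase it, so they kill that eigenspace; the Cartan subalgebra preserves it and has a common
eigenvector there. -/
theorem exists_highestWeightVector [FiniteDimensional ℂ U] [Nontrivial U] :
    ∃ (mu : Fin l → ℂ) (u : U), IsHighestWeightVector mu u := by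
  obtain ⟨t, ht⟩ := exists_grading l
  set H := LieModule.toEnd ℂ (SoEven l) U (cartan t) with hH
  have hfin : {c : ℂ | H.HasEigenvalue c}.Finite := Module.End.finite_hasEigenvalue H
  obtain ⟨c0, hc0⟩ := Module.End.exists_eigenvalue H
  obtain ⟨c, hc, hmax⟩ := hfin.exists_maximalFor Complex.re _ ⟨c0, hc0⟩
  have hmap : ∀ i : Fin l, ∀ x ∈ H.eigenspace c,
      LieModule.toEnd ℂ (SoEven l) U (cartan (Pi.single i 1)) x ∈ H.eigenspace c := by
    intro i x hx
    rw [Module.End.mem_eigenspace_iff] at hx ⊢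
    have := LinearMap.congr_fun (commute_toEnd_cartan (U := U) t (Pi.single i 1)).eq x
    simp only [Module.End.mul_apply] at this
    rw [this, hx, map_smul]
  obtain ⟨χ, u, hu1, hu2, hu3⟩ := exists_common_eigenvector
    (fun i : Fin l => LieModule.toEnd ℂ (SoEven l) U (cartan (Pi.single i 1)))
    (fun i j => commute_toEnd_cartan _ _) (H.eigenspace c) hc hmap
  refine ⟨χ, u, ⟨hu2, mem_weightSpace_of_coord hu3⟩, fun X hX =>
    lie_eq_zero_of_isPositive (fun p q hpq => ?_) hX⟩
  by_contra hne
  rw [Module.End.mem_eigenspace_iff] at hu1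
  have h1 : H ⁅rootElt p q, u⁆ = (c + (signed t p - signed t q)) • ⁅rootElt p q, u⁆ := by
    rw [hH, LieModule.toEnd_apply_apply] at hu1 ⊢
    rw [leibniz_lie, hu1, cartan_lie_rootElt, smul_lie, lie_smul, ← add_smul, add_comm]
  have h2 : H.HasEigenvalue (c + (signed t p - signed t q)) :=
    Module.End.hasEigenvalue_of_hasEigenvector
      ⟨Module.End.mem_eigenspace_iff.mpr h1, hne⟩
  have h3 := ht p q hpq
  have h4 := hmax h2 (by simp only [Complex.add_re]; linarith)
  simp only [Complex.add_re] at h4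
  linarith

/-- The vectors obtained from `v` by applying lowering operators, with the amount by which the
weight has decreased. -/
inductive IsDescendant (v : U) : (Fin l → ℂ) → U → Prop
  | base : IsDescendant v 0 v
  | step {k : Fin l → ℂ} {u : U} (p q : Fin l ⊕ Fin l) : Raises p q → p ≠ q.swap →
      IsDescendant v k u → IsDescendant v (k + (natWeight p - natWeight q)) ⁅rootElt q p, u⁆

theorem IsDescendant.mem_weightSpace {lam k : Fin l → ℂ} {v u : U}
    (hv : v ∈ weightSpace U lam) (h : IsDescendant v k u) : u ∈ weightSpace U (lam - k) := by
  induction h with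
  | base => simpa using hv
  | step p q h1 h2 h3 ih =>
    have := rootElt_lie_mem_weightSpace ih q p
    convert this using 2
    abel

theorem IsDescendant.eq_or {k : Fin l → ℂ} {v u : U} (h : IsDescendant v k u) :
    (k = 0 ∧ u = v) ∨ IsPositiveWeight k := by
  induction h with
  | base => exact Or.inl ⟨rfl, rfl⟩
  | step p q h1 h2 h3 ih =>
    right
    rcases ih with ⟨rfl, -⟩ | ih
    · rw [zero_add]
      exact isPositiveWeight_root h1 h2
    · exact ih.add (isPositiveWeight_root h1 h2)

/-- No ordering of lowering operators is needed. For a descendant `[f, u]`, write `[X, [f, u]] =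
[[X, f], u] + [f, [X, u]]`; the induction hypothesis at `u` covers all elements of the Lie algebra
at once, hence both `[X, f]` and `X`. -/
theorem lie_mem_span_descendants {lam : Fin l → ℂ} {v : U} (hv : IsHighestWeightVector lam v)
    (X : SoEven l) {u : U} (hu : u ∈ Submodule.span ℂ {u | ∃ k : Fin l → ℂ, IsDescendant v k u}) :
    ⁅X, u⁆ ∈ Submodule.span ℂ {u | ∃ k : Fin l → ℂ, IsDescendant v k u} := by
  set N := Submodule.span ℂ {u | ∃ k : Fin l → ℂ, IsDescendant v k u} with hN
  have hstep : ∀ p q : Fin l ⊕ Fin l, Raises p q → ∀ u ∈ N, ⁅rootElt q p, u⁆ ∈ N := by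
    intro p q hpq u hu
    by_cases hpq' : p = q.swap
    · rw [hpq', rootElt_self_swap, zero_lie]
      exact N.zero_mem
    induction hu using Submodule.span_induction with
    | mem x hx =>
      obtain ⟨k, hk⟩ := hx
      exact Submodule.subset_span ⟨_, hk.step p q hpq hpq'⟩
    | zero => simp
    | add x y _ _ hx hy => rw [lie_add]; exact N.add_mem hx hy
    | smul c x _ hx => rw [lie_smul]; exact N.smul_mem c hx
  have hall : ∀ u, (∀ p q : Fin l ⊕ Fin l, ⁅rootElt p q, u⁆ ∈ N) → ∀ X : SoEven l, ⁅X, u⁆ ∈ N := by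
    intro u h X
    rw [lie_eq_sum_rootElt]
    exact N.sum_mem fun p _ => N.sum_mem fun q _ => N.smul_mem _ (h p q)
  have hdesc : ∀ (k : Fin l → ℂ) (u : U), IsDescendant v k u → ∀ X : SoEven l, ⁅X, u⁆ ∈ N := by
    intro k u h
    induction h with
    | base =>
      have hvN : v ∈ N := Submodule.subset_span ⟨0, IsDescendant.base⟩
      refine hall v fun p q => ?_
      rcases raises_trichotomy p q with h | rfl | h
      · rw [hv.2 _ (isPositive_rootElt h)]
        exact N.zero_mem
      · rw [rootElt_self_lie hv.1.2]
        exact N.smul_mem _ hvN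
      · exact hstep q p h v hvN
    | step p q h1 h2 h3 ih =>
      intro X
      rw [leibniz_lie]
      exact N.add_mem (ih _) (hstep p q h1 _ (ih X))
  induction hu using Submodule.span_induction with
  | mem x hx =>
    obtain ⟨k, hk⟩ := hx
    exact hdesc k x hk X
  | zero => simp
  | add x y _ _ hx hy => rw [lie_add]; exact N.add_mem hx hy
  | smul c x _ hx => rw [lie_smul]; exact N.smul_mem c hx

theorem lieSpan_le_span_descendants {lam : Fin l → ℂ} {v : U} (hv : IsHighestWeightVector lam v)
    {u : U} (hu : u ∈ LieSubmodule.lieSpan ℂ (SoEven l) {v}) :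
    u ∈ Submodule.span ℂ {u | ∃ k : Fin l → ℂ, IsDescendant v k u} := by
  let N : LieSubmodule ℂ (SoEven l) U :=
    { Submodule.span ℂ {u | ∃ k : Fin l → ℂ, IsDescendant v k u} with
      lie_mem := fun {X u} hu => lie_mem_span_descendants hv X hu }
  have : LieSubmodule.lieSpan ℂ (SoEven l) {v} ≤ N := by
    rw [LieSubmodule.lieSpan_le, Set.singleton_subset_iff]
    exact Submodule.subset_span ⟨0, IsDescendant.base⟩
  exact this hu

theorem weightSpace_le (mu : Fin l → ℂ) : weightSpace U mu ≤
    ⨅ i, (LieModule.toEnd ℂ (SoEven l) U (cartan (Pi.single i 1))).maxGenEigenspace (mu i) := by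
  refine le_iInf fun i => ?_
  refine le_trans ?_ (Module.End.genEigenspace_le_maximal _ _ 1)
  intro u hu
  change u ∈ Module.End.eigenspace _ _
  rw [Module.End.mem_eigenspace_iff, LieModule.toEnd_apply_apply, hu,
    evalWeight_single]

variable (U) in
-- Weight spaces lie in joint generalized eigenspaces of the commuting coordinate operators, and
-- these are independent.
theorem iSupIndep_weightSpace : iSupIndep (weightSpace (l := l) U) := by
  refine (Module.End.independent_iInf_maxGenEigenspace_of_forall_mapsTo
    (fun i : Fin l => LieModule.toEnd ℂ (SoEven l) U (cartan (Pi.single i 1))) ?_).mono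
    weightSpace_le
  intro i j c
  exact Module.End.mapsTo_maxGenEigenspace_of_comm (commute_toEnd_cartan _ _) _

/-- An eigenspace of the Casimir is a submodule, because the Casimir commutes with the action. -/
theorem casimir_eq_smul_of_mem_lieSpan {c : ℂ} {v u : U} (hv : casimir (l := l) U v = c • v)
    (hu : u ∈ LieSubmodule.lieSpan ℂ (SoEven l) {v}) : casimir (l := l) U u = c • u := by
  let N : LieSubmodule ℂ (SoEven l) U :=
    { LinearMap.ker (casimir (l := l) U - c • (1 : Module.End ℂ U)) with
      lie_mem := fun {X u} hu => by
        simp only [AddSubsemigroup.mem_carrier, AddSubmonoid.mem_toSubsemigroup,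
          Submodule.mem_toAddSubmonoid, LinearMap.mem_ker, LinearMap.sub_apply,
          LinearMap.smul_apply, Module.End.one_apply, sub_eq_zero] at hu ⊢
        rw [← lie_casimir, hu, lie_smul] }
  have hN : ∀ u, u ∈ N ↔ casimir (l := l) U u = c • u := by
    intro u
    change u ∈ LinearMap.ker (casimir (l := l) U - c • (1 : Module.End ℂ U)) ↔ _
    simp [sub_eq_zero]
  have : LieSubmodule.lieSpan ℂ (SoEven l) {v} ≤ N := by
    rw [LieSubmodule.lieSpan_le, Set.singleton_subset_iff]
    exact (hN v).mpr hv
  exact (hN u).mp (this hu)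

/-- A highest weight vector in the module generated by a highest weight vector is proportional
to the generator. -/
theorem exists_eq_smul_of_mem_lieSpan [FiniteDimensional ℂ U] {lam mu : Fin l → ℂ} {v u : U}
    (hv : IsHighestWeightVector lam v) (hu : IsHighestWeightVector mu u)
    (huv : u ∈ LieSubmodule.lieSpan ℂ (SoEven l) {v}) : ∃ a : ℂ, u = a • v := by
  have hc : evalWeight lam (lam + (2 : ℂ) • rho l) = evalWeight mu (mu + (2 : ℂ) • rho l) := by
    have h1 := casimir_eq_smul_of_mem_lieSpan (casimir_lie_eq_smul hv) huv
    rw [casimir_lie_eq_smul hu] at h1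
    have h2 := smul_left_injective ℂ hu.1.1 h1
    simpa using h2.symm
  -- Equal Casimir values say `(λ - μ, λ + μ + 2ρ) = 0`, while a positive `k = λ - μ` pairs
  -- positively with this regular dominant weight.
  have hnot : ∀ k, IsPositiveWeight k → lam - k ≠ mu := by
    intro k hk h
    have h1 := hk _ (hv.isRegularDominant_add hu)
    have h2 : evalWeight k (lam + mu + (2 : ℂ) • rho l) = 0 := by
      have : k = lam - mu := by rw [← h]; abel
      rw [this]
      simp only [evalWeight] at hc ⊢
      rw [← sub_eq_zero, ← Finset.sum_sub_distrib] at hc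
      rw [← hc]
      refine Finset.sum_congr rfl fun i _ => ?_
      simp only [Pi.add_apply, Pi.sub_apply, Pi.smul_apply, smul_eq_mul]
      ring
    rw [h2] at h1
    simp at h1
  -- Every descendant other than `v` has weight different from both λ and μ, so the generated module
  -- is the line of `v` plus foreign weight spaces.
  have hspan : Submodule.span ℂ {u | ∃ k : Fin l → ℂ, IsDescendant v k u} ≤
      Submodule.span ℂ {v} ⊔ ⨆ chi, ⨆ (_ : chi ≠ mu ∧ chi ≠ lam), weightSpace U chi := by
    rw [Submodule.span_le]
    rintro x ⟨k, hk⟩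
    rcases hk.eq_or with ⟨-, rfl⟩ | hpos
    · exact Submodule.mem_sup_left (Submodule.mem_span_singleton_self x)
    · refine Submodule.mem_sup_right (Submodule.mem_iSup_of_mem (lam - k)
        (Submodule.mem_iSup_of_mem ⟨hnot k hpos, ?_⟩ (hk.mem_weightSpace hv.1.2)))
      intro h
      exact hpos.ne_zero (sub_eq_self.mp h)
  obtain ⟨y, hy, z, hz, hyz⟩ := Submodule.mem_sup.mp (hspan (lieSpan_le_span_descendants hv huv))
  obtain ⟨a, rfl⟩ := Submodule.mem_span_singleton.mp hy
  have hz' : ∀ chi, chi = mu ∨ chi = lam → z ∈ ⨆ chi', ⨆ (_ : chi' ≠ chi), weightSpace U chi' := by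
    intro chi hchi
    have hle : ⨆ chi', ⨆ (_ : chi' ≠ mu ∧ chi' ≠ lam), weightSpace U chi' ≤
        ⨆ chi', ⨆ (_ : chi' ≠ chi), weightSpace U chi' := by
      refine iSup_mono fun chi' => iSup_le fun h => le_iSup_of_le ?_ le_rfl
      rcases hchi with rfl | rfl
      exacts [h.1, h.2]
    exact hle hz
  have hind := iSupIndep_weightSpace (l := l) U
  -- If the weights agree, the remainder `z` lies in the λ-weight space and in the sum of the
  -- others, hence is zero. If they differ, `u` itself lies in the sum of the weight spaces other
  -- than its own, contradicting `u ≠ 0`.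
  by_cases hml : mu = lam
  · have hzl : z ∈ weightSpace U lam := by
      have : z = u - a • v := by rw [← hyz]; abel
      rw [this]
      exact Submodule.sub_mem _ (hml ▸ hu.1.2) (Submodule.smul_mem _ _ hv.1.2)
    have := Submodule.disjoint_def.mp (hind lam) z hzl (hz' lam (Or.inr rfl))
    exact ⟨a, by rw [← hyz, this, add_zero]⟩
  · exfalso
    refine hu.1.1 (Submodule.disjoint_def.mp (hind mu) u hu.1.2 ?_)
    rw [← hyz]
    refine Submodule.add_mem _ ?_ (hz' mu (Or.inl rfl))
    exact Submodule.smul_mem _ _ (Submodule.mem_iSup_of_mem lam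
      (Submodule.mem_iSup_of_mem (Ne.symm hml) hv.1.2))

/-- A highest weight vector of a finite-dimensional module generates an irreducible module. -/
theorem isIrrep_lieSpan [FiniteDimensional ℂ U] {lam : Fin l → ℂ} {v : U}
    (hv : IsHighestWeightVector lam v) :
    IsIrrep lam (LieSubmodule.lieSpan ℂ (SoEven l) ({v} : Set U)) := by
  set N := LieSubmodule.lieSpan ℂ (SoEven l) ({v} : Set U) with hN
  have hvN : v ∈ N := LieSubmodule.subset_lieSpan (Set.mem_singleton v)
  have hfin : FiniteDimensional ℂ N := inferInstanceAs (FiniteDimensional ℂ N.toSubmodule)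
  refine ⟨hfin, ?_, ⟨v, hvN⟩, ⟨?_, ?_⟩, ?_⟩
  · have : Nontrivial N := ⟨⟨⟨v, hvN⟩, 0, by simpa [Subtype.ext_iff] using hv.1.1⟩⟩
    refine LieModule.IsIrreducible.mk fun P hP => ?_
    have hPn : Nontrivial P := (LieSubmodule.nontrivial_iff_ne_bot ℂ (SoEven l) N).mpr hP
    have hPf : FiniteDimensional ℂ P := inferInstanceAs (FiniteDimensional ℂ P.toSubmodule)
    -- A nonzero submodule has a highest weight vector of its own; being a multiple of `v`, it puts
    -- the generator into the submodule.
    obtain ⟨mu, u, hu⟩ := exists_highestWeightVector (l := l) (U := P)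
    have hu' : IsHighestWeightVector mu (u : N).1 := by
      refine ⟨⟨?_, fun t => ?_⟩, fun X hX => ?_⟩
      · exact fun h => hu.1.1 (Subtype.ext (Subtype.ext h))
      · exact congrArg (fun w : P => (w : N).1) (hu.1.2 t)
      · exact congrArg (fun w : P => (w : N).1) (hu.2 X hX)
    obtain ⟨a, ha⟩ := exists_eq_smul_of_mem_lieSpan hv hu' (u : N).2
    have ha0 : a ≠ 0 := by
      rintro rfl
      exact hu'.1.1 (by rw [ha, zero_smul])
    have hvP : (⟨v, hvN⟩ : N) ∈ P := by
      have : (⟨v, hvN⟩ : N) = a⁻¹ • (u : N) := by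
        apply Subtype.ext
        change v = a⁻¹ • (u : N).1
        rw [ha, smul_smul, inv_mul_cancel₀ ha0, one_smul]
      rw [this]
      exact P.smul_mem _ u.2
    have hle : N ≤ P.map N.incl := by
      refine LieSubmodule.lieSpan_le.mpr (Set.singleton_subset_iff.mpr ?_)
      exact LieSubmodule.mem_map_of_mem (f := N.incl) hvP
    rw [eq_top_iff]
    intro x _
    obtain ⟨y, hy, hyx⟩ := (LieSubmodule.mem_map _).mp (hle x.2)
    have : y = x := Subtype.ext hyx
    exact this ▸ hy
  · simpa [Subtype.ext_iff] using hv.1.1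
  · intro t
    exact Subtype.ext (hv.1.2 t)
  · intro X hX
    exact Subtype.ext (hv.2 X hX)

theorem irrepExists_of_highestWeightVector {U : Type} [AddCommGroup U] [Module ℂ U]
    [LieRingModule (SoEven l) U] [LieModule ℂ (SoEven l) U] [FiniteDimensional ℂ U]
    {lam : Fin l → ℂ} {v : U} (hv : IsHighestWeightVector lam v) : IrrepExists lam :=
  ⟨_, _, _, _, _, isIrrep_lieSpan hv⟩

theorem IsIrrep.casimir_eq_smul {lam : Fin l → ℂ} (h : IsIrrep lam U) (u : U) :
    casimir (l := l) U u = (2 * evalWeight lam (lam + (2 : ℂ) • rho l)) • u := by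
  obtain ⟨v, hv⟩ := h.highestWeight
  have := h.irreducible
  refine casimir_eq_smul_of_mem_lieSpan (casimir_lie_eq_smul hv) ?_
  have htop : LieSubmodule.lieSpan ℂ (SoEven l) ({v} : Set U) = ⊤ := by
    refine (IsSimpleOrder.eq_bot_or_eq_top _).resolve_left fun h0 => hv.1.1 ?_
    have : v ∈ LieSubmodule.lieSpan ℂ (SoEven l) ({v} : Set U) :=
      LieSubmodule.subset_lieSpan (Set.mem_singleton v)
    rw [h0] at this
    exact (LieSubmodule.mem_bot v).mp this
  rw [htop]
  exact LieSubmodule.mem_top u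

end HighestWeight

/-! ### The operator `M(C)` through Casimir operators. -/

section TensorCasimir

variable {l : ℕ} {V W : Type*}
  [AddCommGroup V] [Module ℂ V] [LieRingModule (SoEven l) V] [LieModule ℂ (SoEven l) V]
  [AddCommGroup W] [Module ℂ W] [LieRingModule (SoEven l) W] [LieModule ℂ (SoEven l) W]

variable (V W) in
/-- The mixed part of the Casimir operator of a tensor product. -/
noncomputable def mixedCasimir : Module.End ℂ (V ⊗[ℂ] W) :=
  ∑ p, ∑ q, TensorProduct.map (LieModule.toEnd ℂ (SoEven l) V (rootElt p q))
    (LieModule.toEnd ℂ (SoEven l) W (rootElt q p))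

/-- The canonical tensor contracted with the bilinear map built from the two actions. The right side
makes independence of the basis visible. -/
theorem mOperator_eq_smul (hl : 2 ≤ l) {m : ℕ} (x : Module.Basis (Fin m) ℂ (SoEven l)) :
    mOperator hl x V W = (4 * (2 * l - 2) : ℂ)⁻¹ • mixedCasimir (l := l) V W :=
  sum_dualBasis_eq hl x ((TensorProduct.mapBilinear (RingHom.id ℂ) V W V W).compl₁₂
    (LieModule.toEnd ℂ (SoEven l) V : SoEven l →ₗ[ℂ] Module.End ℂ V)
    (LieModule.toEnd ℂ (SoEven l) W : SoEven l →ₗ[ℂ] Module.End ℂ W))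

/-- Each factor acts on a tensor by the Leibniz rule. The two mixed terms coincide after exchanging
`p` and `q`, hence the coefficient 2. -/
theorem casimir_tensor (z : V ⊗[ℂ] W) : casimir (l := l) (V ⊗[ℂ] W) z =
    TensorProduct.map (casimir (l := l) V) LinearMap.id z +
      TensorProduct.map LinearMap.id (casimir (l := l) W) z +
        (2 : ℂ) • mixedCasimir (l := l) V W z := by
  induction z with
  | zero => simp
  | add x y hx hy => simp only [map_add, hx, hy, smul_add]; abel
  | tmul v w =>
    have h : mixedCasimir (l := l) V W (v ⊗ₜ w) =
        ∑ p, ∑ q, ⁅rootElt (l := l) q p, v⁆ ⊗ₜ[ℂ] ⁅rootElt (l := l) p q, w⁆ := by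
      rw [Finset.sum_comm]
      simp [mixedCasimir, LinearMap.sum_apply]
    rw [two_smul]
    nth_rewrite 1 [h]
    simp only [casimir_apply, mixedCasimir, LinearMap.sum_apply, TensorProduct.map_tmul,
      TensorProduct.LieModule.lie_tmul_right, lie_add, LinearMap.id_apply,
      LieModule.toEnd_apply_apply, TensorProduct.sum_tmul, TensorProduct.tmul_sum,
      Finset.sum_add_distrib]
    abel

/-- The scalar by which `M(C)` acts on a component. -/
noncomputable def mScalar (om nu sig : Fin l → ℂ) : ℂ :=
  (4 * (2 * l - 2) : ℂ)⁻¹ * (evalWeight sig (sig + (2 : ℂ) • rho l)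
    - evalWeight om (om + (2 : ℂ) • rho l) - evalWeight nu (nu + (2 : ℂ) • rho l))

/-- All three Casimir operators in `casimir_tensor` act by scalars on `N`, so the mixed part does as
well. -/
theorem isComponentWithMEigenvalue (hl : 2 ≤ l) {om nu sig : Fin l → ℂ} (hV : IsIrrep om V)
    (hW : IsIrrep nu W) {N : LieSubmodule ℂ (SoEven l) (V ⊗[ℂ] W)} (hN : IsIrrep sig N) :
    IsComponentWithMEigenvalue hl sig N (mScalar om nu sig) := by
  refine ⟨hN, fun m x w hw => ?_⟩
  have h1 : casimir (l := l) (V ⊗[ℂ] W) w =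
      (2 * evalWeight sig (sig + (2 : ℂ) • rho l)) • w := by
    have := congrArg Subtype.val (hN.casimir_eq_smul ⟨w, hw⟩)
    rw [casimir_apply] at this ⊢
    simpa using this
  have h2 : casimir (l := l) V = (2 * evalWeight om (om + (2 : ℂ) • rho l)) • LinearMap.id :=
    LinearMap.ext hV.casimir_eq_smul
  have h3 : casimir (l := l) W = (2 * evalWeight nu (nu + (2 : ℂ) • rho l)) • LinearMap.id :=
    LinearMap.ext hW.casimir_eq_smul
  rw [casimir_tensor, h2, h3, TensorProduct.map_smul_left, TensorProduct.map_smul_right,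
    TensorProduct.map_id] at h1
  simp only [LinearMap.smul_apply, LinearMap.id_apply] at h1
  have h4 : mixedCasimir (l := l) V W w = (evalWeight sig (sig + (2 : ℂ) • rho l)
      - evalWeight om (om + (2 : ℂ) • rho l) - evalWeight nu (nu + (2 : ℂ) • rho l)) • w := by
    have h5 : (2 : ℂ) • mixedCasimir (l := l) V W w = (2 : ℂ) •
        (evalWeight sig (sig + (2 : ℂ) • rho l) - evalWeight om (om + (2 : ℂ) • rho l)
          - evalWeight nu (nu + (2 : ℂ) • rho l)) • w := by
      rw [← eq_sub_iff_add_eq'] at h1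
      rw [h1]
      module
    exact smul_right_injective _ (two_ne_zero' ℂ) h5
  rw [mOperator_eq_smul, LinearMap.smul_apply, h4, smul_smul, mScalar]

theorem tmul_mem_weightSpace {chi psi : Fin l → ℂ} {v : V} {w : W} (hv : v ∈ weightSpace V chi)
    (hw : w ∈ weightSpace W psi) : v ⊗ₜ[ℂ] w ∈ weightSpace (V ⊗[ℂ] W) (chi + psi) := by
  intro t
  rw [TensorProduct.LieModule.lie_tmul_right, hv, hw, ← TensorProduct.smul_tmul',
    TensorProduct.tmul_smul, evalWeight_add, add_smul]

end TensorCasimir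

/-! ### Simple root vectors and their relations. -/

section SimpleRoots

variable {l : ℕ}

/-- The first index of the root vector of a simple root. -/
def simpleFst (j : Fin l) : Fin l ⊕ Fin l :=
  if j.val + 1 < l then Sum.inl j else Sum.inl ⟨j.val - 1, by omega⟩

/-- The second index of the root vector of a simple root. -/
def simpleSnd (j : Fin l) : Fin l ⊕ Fin l :=
  if h : j.val + 1 < l then Sum.inl ⟨j.val + 1, h⟩ else Sum.inr j

theorem simpleFst_of_lt {j : Fin l} (h : j.val + 1 < l) : simpleFst j = Sum.inl j := if_pos h

theorem simpleSnd_of_lt {j : Fin l} (h : j.val + 1 < l) :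
    simpleSnd j = Sum.inl ⟨j.val + 1, h⟩ := dif_pos h

theorem simpleFst_of_not_lt {j : Fin l} (h : ¬ j.val + 1 < l) :
    simpleFst j = Sum.inl ⟨j.val - 1, by omega⟩ := if_neg h

theorem simpleSnd_of_not_lt {j : Fin l} (h : ¬ j.val + 1 < l) : simpleSnd j = Sum.inr j :=
  dif_neg h

/-- The simple root vectors. -/
def simpleRaise (j : Fin l) : SoEven l := rootElt (simpleFst j) (simpleSnd j)

/-- The root vectors of the negatives of the simple roots. -/
def simpleLower (j : Fin l) : SoEven l := rootElt (simpleSnd j) (simpleFst j)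

theorem raises_simple (j : Fin l) : Raises (simpleFst j) (simpleSnd j) := by
  by_cases h : j.val + 1 < l
  · rw [simpleFst_of_lt h, simpleSnd_of_lt h]
    simp [Raises, Fin.lt_def]
  · rw [simpleFst_of_not_lt h, simpleSnd_of_not_lt h]
    trivial

theorem simpleFst_ne_swap (hl : 2 ≤ l) (j : Fin l) : simpleFst j ≠ (simpleSnd j).swap := by
  by_cases h : j.val + 1 < l
  · rw [simpleFst_of_lt h, simpleSnd_of_lt h]
    simp
  · rw [simpleFst_of_not_lt h, simpleSnd_of_not_lt h]
    simp [Fin.ext_iff]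
    omega

/-- Type D is simply laced, so roots and coroots have the same coordinates; this justifies
subtracting `simpleCoroot` from weights below. -/
theorem simpleCoroot_eq (hl : 2 ≤ l) (j : Fin l) :
    simpleCoroot l j = natWeight (simpleFst j) - natWeight (simpleSnd j) := by
  ext i
  by_cases h : j.val + 1 < l
  · rw [simpleFst_of_lt h, simpleSnd_of_lt h]
    simp only [simpleCoroot, h, if_true, natWeight, Sum.elim_inl, Pi.sub_apply, Pi.single_apply,
      Fin.ext_iff]
    split_ifs <;> first | omega | simp
  · rw [simpleFst_of_not_lt h, simpleSnd_of_not_lt h]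
    simp only [simpleCoroot, h, if_false, natWeight, Sum.elim_inl, Sum.elim_inr, Pi.sub_apply,
      Pi.neg_apply, Pi.single_apply, Fin.ext_iff]
    split_ifs <;> first | omega | simp

theorem dynkinLabel_eq_signed (hl : 2 ≤ l) (lam : Fin l → ℂ) (j : Fin l) :
    dynkinLabel lam j = signed lam (simpleFst j) - signed lam (simpleSnd j) := by
  rw [dynkinLabel, evalWeight_comm, simpleCoroot_eq hl, evalWeight_sub, evalWeight_natWeight,
    evalWeight_natWeight]

theorem dynkinLabel_add (x y : Fin l → ℂ) (j : Fin l) :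
    dynkinLabel (x + y) j = dynkinLabel x j + dynkinLabel y j := evalWeight_add _ _ _

theorem dynkinLabel_sub (x y : Fin l → ℂ) (j : Fin l) :
    dynkinLabel (x - y) j = dynkinLabel x j - dynkinLabel y j := evalWeight_sub _ _ _

/-- A difference of two distinct simple roots is not a root. For the two spin nodes the bracket
formula may leave a term, but it is an element attached to a pair `(r, r')`, which is zero. -/
theorem simpleRaise_lie_simpleLower {i j : Fin l} (hij : i ≠ j) :
    ⁅simpleRaise i, simpleLower j⁆ = 0 := by
  rw [simpleRaise, simpleLower, rootElt_lie_rootElt]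
  have hij' : i.val ≠ j.val := fun h => hij (Fin.ext h)
  have hz : ∀ r : Fin l, rootElt (Sum.inr r) (Sum.inl r) = 0 := fun r =>
    rootElt_self_swap (Sum.inr r)
  have hz' : ∀ r : Fin l, rootElt (Sum.inl r) (Sum.inr r) = 0 := fun r =>
    rootElt_self_swap (Sum.inl r)
  by_cases hi : i.val + 1 < l <;> by_cases hj : j.val + 1 < l
  · rw [simpleFst_of_lt hi, simpleSnd_of_lt hi, simpleFst_of_lt hj, simpleSnd_of_lt hj]
    simp [Fin.ext_iff, hij', hij'.symm]
  · rw [simpleFst_of_lt hi, simpleSnd_of_lt hi, simpleFst_of_not_lt hj, simpleSnd_of_not_lt hj]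
    have h1 : ¬ (j.val = i.val) := hij'.symm
    simp only [Sum.swap_inl, Fin.ext_iff, Sum.inl.injEq, Sum.inr.injEq, reduceCtorEq, if_false,
      h1, sub_zero, zero_sub, add_zero]
    split_ifs with h
    · have : (⟨i.val + 1, hi⟩ : Fin l) = j := Fin.ext (by simp only; omega)
      rw [this, hz, neg_zero]
    · rw [neg_zero]
  · rw [simpleFst_of_not_lt hi, simpleSnd_of_not_lt hi, simpleFst_of_lt hj, simpleSnd_of_lt hj]
    have h1 : ¬ (j.val = i.val) := hij'.symm
    simp only [Sum.swap_inl, Sum.swap_inr, Fin.ext_iff, Sum.inl.injEq, reduceCtorEq, if_false,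
      h1, sub_zero, zero_sub, add_zero]
    split_ifs with h
    · have : (⟨j.val + 1, hj⟩ : Fin l) = i := Fin.ext (by simp only; omega)
      rw [this, hz', neg_zero]
    · rw [neg_zero]
  · omega

variable {U : Type*} [AddCommGroup U] [Module ℂ U] [LieRingModule (SoEven l) U]
  [LieModule ℂ (SoEven l) U]

theorem simpleLower_lie_mem (hl : 2 ≤ l) {lam : Fin l → ℂ} {u : U} (hu : u ∈ weightSpace U lam)
    (j : Fin l) : ⁅simpleLower j, u⁆ ∈ weightSpace U (lam - simpleCoroot l j) := by
  have := rootElt_lie_mem_weightSpace hu (simpleSnd j) (simpleFst j)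
  have e : lam - simpleCoroot l j = lam + (natWeight (simpleSnd j) - natWeight (simpleFst j)) := by
    rw [simpleCoroot_eq hl]
    abel
  rw [e]
  exact this

theorem simpleRaise_lie_simpleLower_lie (hl : 2 ≤ l) {lam : Fin l → ℂ} {u : U}
    (hu : u ∈ weightSpace U lam) (i j : Fin l) :
    ⁅simpleRaise i, ⁅simpleLower j, u⁆⁆ = ⁅simpleLower j, ⁅simpleRaise i, u⁆⁆ +
      (if i = j then dynkinLabel lam i else 0) • u := by
  rw [leibniz_lie, add_comm]
  congr 1
  by_cases h : i = j
  · subst h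
    rw [if_pos rfl, simpleRaise, simpleLower,
      rootElt_lie_rootElt_opp (raises_simple i).ne (simpleFst_ne_swap hl i), sub_lie,
      rootElt_self_lie hu, rootElt_self_lie hu, dynkinLabel_eq_signed hl, sub_smul]
  · rw [simpleRaise_lie_simpleLower h, if_neg h, zero_lie, zero_smul]

/-- In a finite-dimensional module, a lowering operator kills highest weight vectors with
vanishing label. -/
theorem IsHighestWeightVector.simpleLower_lie_eq_zero (hl : 2 ≤ l) [FiniteDimensional ℂ U]
    {lam : Fin l → ℂ} {v : U} (hv : IsHighestWeightVector lam v) {j : Fin l}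
    (hj : dynkinLabel lam j = 0) : ⁅simpleLower j, v⁆ = 0 := by
  have h1 := hv.primitive (raises_simple j) (raises_simple j).ne (simpleFst_ne_swap hl j)
  have h2 := h1.pow_toEnd_f_eq_zero_of_eq_nat (n := 0)
    (by rw [← dynkinLabel_eq_signed hl, hj, Nat.cast_zero])
  rwa [zero_add, pow_one, LieModule.toEnd_apply_apply] at h2

/-- The simple root vectors generate the positive part. -/
theorem isPositive_lie_eq_zero_of_simple (hl : 2 ≤ l) {u : U}
    (h : ∀ i, ⁅(simpleRaise i : SoEven l), u⁆ = 0) {X : SoEven l} (hX : IsPositive X) :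
    ⁅X, u⁆ = 0 := by
  -- The annihilator of `u` is closed under brackets; the inequalities ensure that the bracket is
  -- exactly the root element of `(p, r)`.
  have hbr : ∀ p q r : Fin l ⊕ Fin l, p ≠ q → p ≠ q.swap → p ≠ r → p ≠ r.swap → q ≠ r →
      q ≠ r.swap → ⁅rootElt p q, u⁆ = 0 → ⁅rootElt q r, u⁆ = 0 → ⁅rootElt p r, u⁆ = 0 := by
    intro p q r h1 h2 h3 h4 h5 h6 hpq hqr
    have e : rootElt p r = ⁅rootElt p q, rootElt q r⁆ := by
      have h2' : q ≠ p.swap := by rintro rfl; simp at h2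
      have h6' : r ≠ q.swap := by rintro rfl; simp at h6
      rw [rootElt_lie_rootElt]
      simp [h2', h3.symm, h6']
    rw [e, lie_lie, hpq, hqr, lie_zero, lie_zero, sub_zero]
  have h1 : ∀ (d : ℕ) (i j : Fin l), j.val = i.val + d + 1 →
      ⁅rootElt (Sum.inl i) (Sum.inl j), u⁆ = 0 := by
    intro d
    induction d with
    | zero =>
      intro i j hij
      have hi : i.val + 1 < l := by omega
      have := h i
      rw [simpleRaise, simpleFst_of_lt hi, simpleSnd_of_lt hi] at this
      have hj : j = ⟨i.val + 1, hi⟩ := Fin.ext (by simp only; omega)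
      rw [hj, this]
    | succ d ih =>
      intro i j hij
      have hk := ih i ⟨i.val + d + 1, by omega⟩ rfl
      have hk' : (⟨i.val + d + 1, by omega⟩ : Fin l).val + 1 < l := by simp only; omega
      have := h ⟨i.val + d + 1, by omega⟩
      rw [simpleRaise, simpleFst_of_lt hk', simpleSnd_of_lt hk'] at this
      have hj : j = ⟨i.val + d + 1 + 1, by omega⟩ := Fin.ext (by simp only; omega)
      rw [hj]
      refine hbr _ _ _ ?_ ?_ ?_ ?_ ?_ ?_ hk this <;> simp [Fin.ext_iff] <;> omega
  have h2 : ∀ i j : Fin l, i < j → ⁅rootElt (Sum.inl i) (Sum.inl j), u⁆ = 0 := by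
    intro i j hij
    exact h1 (j.val - i.val - 1) i j (by omega)
  set z : Fin l := ⟨l - 1, by omega⟩ with hz
  have hlast : ⁅rootElt (Sum.inl ⟨l - 2, by omega⟩) (Sum.inr z), u⁆ = 0 := by
    have hz' : ¬ z.val + 1 < l := by simp only [hz]; omega
    have := h z
    rw [simpleRaise, simpleFst_of_not_lt hz', simpleSnd_of_not_lt hz'] at this
    exact this
  have h3 : ∀ i : Fin l, i ≠ z → ⁅rootElt (Sum.inl i) (Sum.inr z), u⁆ = 0 := by
    intro i hi
    have hi' : i.val ≠ l - 1 := fun h => hi (Fin.ext h)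
    by_cases hi2 : i.val = l - 2
    · have : i = ⟨l - 2, by omega⟩ := Fin.ext hi2
      rw [this, hlast]
    · have := h2 i ⟨l - 2, by omega⟩ (by simp only [Fin.lt_def]; omega)
      refine hbr _ _ _ ?_ ?_ ?_ ?_ ?_ ?_ this hlast <;> simp [Fin.ext_iff, hz] <;> omega
  have hanti : ∀ i j : Fin l, ⁅rootElt (Sum.inl i) (Sum.inr j), u⁆ =
      - ⁅rootElt (Sum.inl j) (Sum.inr i), u⁆ := by
    intro i j
    have := rootElt_swap (Sum.inl j) (Sum.inr i)
    simp only [Sum.swap_inl, Sum.swap_inr] at this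
    rw [this, neg_lie]
  have h4 : ∀ i j : Fin l, ⁅rootElt (Sum.inl i) (Sum.inr j), u⁆ = 0 := by
    intro i j
    by_cases hij : i = j
    · rw [hij]
      have : rootElt (Sum.inl j) (Sum.inr j) = 0 := rootElt_self_swap (Sum.inl j)
      rw [this, zero_lie]
    by_cases hj : j = z
    · subst hj
      exact h3 i hij
    by_cases hi : i = z
    · subst hi
      rw [hanti, h3 j hj, neg_zero]
    -- The remaining roots split as `μ_i + μ_j = (μ_i - μ_z) + (μ_z + μ_j)`, with `z` the last
    -- index.
    have hiz : i < z := lt_of_le_of_ne (by simp only [Fin.le_def, hz]; omega) hi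
    have e := h3 j hj
    rw [hanti, neg_eq_zero] at e
    refine hbr _ _ _ ?_ ?_ ?_ ?_ ?_ ?_ (h2 i z hiz) e <;> simp [hi, hij, Ne.symm hj]
  refine lie_eq_zero_of_isPositive (fun p q hpq => ?_) hX
  rcases p with i | i <;> rcases q with j | j <;> simp only [Raises] at hpq
  · exact h2 i j hpq
  · exact h4 i j
  · have := rootElt_swap (Sum.inl j) (Sum.inl i)
    simp only [Sum.swap_inl] at this
    rw [this, neg_lie, h2 j i hpq, neg_zero]

end SimpleRoots

theorem tmul_ne_zero {V W : Type*} [AddCommGroup V] [Module ℂ V] [AddCommGroup W] [Module ℂ W]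
    {v : V} {w : W} (hv : v ≠ 0) (hw : w ≠ 0) : v ⊗ₜ[ℂ] w ≠ 0 := by
  intro h
  obtain ⟨f, hf⟩ : ∃ f : Module.Dual ℂ V, f v ≠ 0 := by
    by_contra! h0
    exact hv ((Module.forall_dual_apply_eq_zero_iff ℂ v).mp h0)
  have h1 := congrArg (TensorProduct.lid ℂ W ∘ f.rTensor W) h
  simp [hf, hw] at h1

/-! ### Highest weight vectors in tensor products from A₃ chains. -/

section Chains

variable {l : ℕ}

/-- The simple roots `a`, `b`, `c` form a Dynkin diagram of type `A₃` with middle node `b`. -/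
structure IsChain (a b c : Fin l) : Prop where
  a_ne_b : a ≠ b
  b_ne_c : b ≠ c
  a_ne_c : a ≠ c
  self : ∀ i, dynkinLabel (simpleCoroot l i) i = 2
  ab : dynkinLabel (simpleCoroot l a) b = -1
  ba : dynkinLabel (simpleCoroot l b) a = -1
  bc : dynkinLabel (simpleCoroot l b) c = -1
  cb : dynkinLabel (simpleCoroot l c) b = -1
  ac : dynkinLabel (simpleCoroot l a) c = 0
  ca : dynkinLabel (simpleCoroot l c) a = 0
  lower_comm : ⁅(simpleLower a : SoEven l), simpleLower c⁆ = 0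

variable {a b c : Fin l}

theorem IsChain.lower_lie_lower {U : Type*} [AddCommGroup U] [Module ℂ U]
    [LieRingModule (SoEven l) U] [LieModule ℂ (SoEven l) U] (h : IsChain a b c) (u : U) :
    ⁅simpleLower a, ⁅simpleLower c, u⁆⁆ = ⁅simpleLower c, ⁅simpleLower a, u⁆⁆ := by
  rw [leibniz_lie, h.lower_comm, zero_lie, zero_add]

/-- The action of the simple root vectors on the string of weight vectors below the highest weight
vector of a module with labels `1, 0, 0` along the chain. -/
theorem IsChain.raise_string {V : Type*} [AddCommGroup V] [Module ℂ V]
    [LieRingModule (SoEven l) V] [LieModule ℂ (SoEven l) V] [FiniteDimensional ℂ V]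
    (hl : 2 ≤ l) (h : IsChain a b c) {om : Fin l → ℂ} {v : V} (hv : IsHighestWeightVector om v)
    (ha : dynkinLabel om a = 1) (hb : dynkinLabel om b = 0) (hc : dynkinLabel om c = 0)
    (i : Fin l) :
    ⁅simpleRaise i, v⁆ = 0 ∧
    ⁅simpleRaise i, ⁅simpleLower a, v⁆⁆ = (if i = a then 1 else 0 : ℂ) • v ∧
    ⁅simpleRaise i, ⁅simpleLower b, ⁅simpleLower a, v⁆⁆⁆ =
      (if i = b then 1 else 0 : ℂ) • ⁅simpleLower a, v⁆ ∧
    ⁅simpleRaise i, ⁅simpleLower c, ⁅simpleLower b, ⁅simpleLower a, v⁆⁆⁆⁆ =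
      (if i = c then 1 else 0 : ℂ) • ⁅simpleLower b, ⁅simpleLower a, v⁆⁆ := by
  have h0 := hv.1.2
  have m0 : v ∈ weightSpace V om := h0
  have m1 := simpleLower_lie_mem hl m0 a
  have m2 := simpleLower_lie_mem hl m1 b
  have kb := hv.simpleLower_lie_eq_zero hl hb
  have kc := hv.simpleLower_lie_eq_zero hl hc
  have e0 : ∀ i, ⁅simpleRaise i, v⁆ = 0 := fun i => hv.2 _ (isPositive_rootElt (raises_simple i))
  have e1 : ∀ i, ⁅simpleRaise i, ⁅simpleLower a, v⁆⁆ = (if i = a then 1 else 0 : ℂ) • v := by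
    intro i
    rw [simpleRaise_lie_simpleLower_lie hl m0, e0, lie_zero, zero_add]
    split_ifs with h1
    · rw [h1, ha]
    · rfl
  have e2 : ∀ i, ⁅simpleRaise i, ⁅simpleLower b, ⁅simpleLower a, v⁆⁆⁆ =
      (if i = b then 1 else 0 : ℂ) • ⁅simpleLower a, v⁆ := by
    intro i
    rw [simpleRaise_lie_simpleLower_lie hl m1, e1, lie_smul, kb, smul_zero, zero_add]
    split_ifs with h1
    · rw [h1, dynkinLabel_sub, hb, h.ab]; norm_num
    · rfl
  refine ⟨e0 i, e1 i, e2 i, ?_⟩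
  rw [simpleRaise_lie_simpleLower_lie hl m2, e2, lie_smul, ← h.lower_lie_lower, kc, lie_zero,
    smul_zero, zero_add]
  split_ifs with h1
  · rw [h1, dynkinLabel_sub, dynkinLabel_sub, hc, h.ac, h.bc]; norm_num
  · rfl

/-- The lowest vector of the string is nonzero. -/
theorem IsChain.string_ne_zero {V : Type*} [AddCommGroup V] [Module ℂ V]
    [LieRingModule (SoEven l) V] [LieModule ℂ (SoEven l) V] [FiniteDimensional ℂ V]
    (hl : 2 ≤ l) (h : IsChain a b c) {om : Fin l → ℂ} {v : V} (hv : IsHighestWeightVector om v)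
    (ha : dynkinLabel om a = 1) (hb : dynkinLabel om b = 0) (hc : dynkinLabel om c = 0) :
    ⁅simpleLower b, ⁅simpleLower a, v⁆⁆ ≠ 0 ∧
    ⁅simpleLower c, ⁅simpleLower b, ⁅simpleLower a, v⁆⁆⁆ ≠ 0 := by
  have key := h.raise_string hl hv ha hb hc
  have h1 : ⁅simpleLower a, v⁆ ≠ 0 := by
    intro h0
    have := (key a).2.1
    rw [h0, lie_zero, if_pos rfl, one_smul] at this
    exact hv.1.1 this.symm
  have h2 : ⁅simpleLower b, ⁅simpleLower a, v⁆⁆ ≠ 0 := by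
    intro h0
    have := (key b).2.2.1
    rw [h0, lie_zero, if_pos rfl, one_smul] at this
    exact h1 this.symm
  refine ⟨h2, fun h0 => ?_⟩
  have := (key c).2.2.2
  rw [h0, lie_zero, if_pos rfl, one_smul] at this
  exact h2 this.symm

/-- The weight of the lowest vector of the string is a weight of the module. -/
theorem IsChain.isWeightOf {V : Type*} [AddCommGroup V] [Module ℂ V]
    [LieRingModule (SoEven l) V] [LieModule ℂ (SoEven l) V]
    (hl : 2 ≤ l) (h : IsChain a b c) {om : Fin l → ℂ} (hV : IsIrrep om V)
    (ha : dynkinLabel om a = 1) (hb : dynkinLabel om b = 0) (hc : dynkinLabel om c = 0) :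
    IsWeightOf (om - simpleCoroot l a - simpleCoroot l b - simpleCoroot l c) V := by
  have := hV.finiteDimensional
  obtain ⟨v, hv⟩ := hV.highestWeight
  have m0 : v ∈ weightSpace V om := hv.1.2
  exact ⟨_, (h.string_ne_zero hl hv ha hb hc).2, simpleLower_lie_mem hl (simpleLower_lie_mem hl
    (simpleLower_lie_mem hl m0 a) b) c⟩

variable {V W : Type*}
  [AddCommGroup V] [Module ℂ V] [LieRingModule (SoEven l) V] [LieModule ℂ (SoEven l) V]
  [AddCommGroup W] [Module ℂ W] [LieRingModule (SoEven l) W] [LieModule ℂ (SoEven l) W]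

/-- An explicit vector of weight `ν + ω - α_a - α_b - α_c` in a tensor product. -/
noncomputable def chainVector (a b c : Fin l) (v : V) (w : W) (x y z : ℂ) : V ⊗[ℂ] W :=
  -- With `x`, `y`, `z` the labels of ν along the chain, the factors are the values of ν + ρ on the
  -- coroots `c`, `b + c`, `a + b + c`, each lowered by one. Coefficients are kept polynomial to
  -- avoid denominators.
  (z * (y + z + 1) * (x + y + z + 2)) •
      ⁅simpleLower c, ⁅simpleLower b, ⁅simpleLower a, v⁆⁆⁆ ⊗ₜ[ℂ] w
    - ((y + z + 1) * (x + y + z + 2)) •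
      ⁅simpleLower b, ⁅simpleLower a, v⁆⁆ ⊗ₜ[ℂ] ⁅simpleLower c, w⁆
    + (x + y + z + 2) • ⁅simpleLower a, v⁆ ⊗ₜ[ℂ]
      ((z + 1) • ⁅simpleLower b, ⁅simpleLower c, w⁆⁆ - z • ⁅simpleLower c, ⁅simpleLower b, w⁆⁆)
    - v ⊗ₜ[ℂ] (((y + z + 2) * (z + 1)) • ⁅simpleLower a, ⁅simpleLower b, ⁅simpleLower c, w⁆⁆⁆
      - ((y + z + 2) * z) • ⁅simpleLower a, ⁅simpleLower c, ⁅simpleLower b, w⁆⁆⁆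
      - ((y + z + 1) * (z + 1)) • ⁅simpleLower b, ⁅simpleLower a, ⁅simpleLower c, w⁆⁆⁆
      + ((y + z + 1) * z) • ⁅simpleLower c, ⁅simpleLower b, ⁅simpleLower a, w⁆⁆⁆)

/-- Moving a raising operator through each lowering word leaves shorter words with label
coefficients. For a node of the chain these cancel identically in the labels, using only that the
lowering operators of `a` and `c` commute; for any other node every term vanishes. -/
theorem IsChain.raise_chainVector [FiniteDimensional ℂ V]
    (hl : 2 ≤ l) (h : IsChain a b c) {om nu : Fin l → ℂ} {v : V} {w : W}
    (hv : IsHighestWeightVector om v) (hw : IsHighestWeightVector nu w)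
    (ha : dynkinLabel om a = 1) (hb : dynkinLabel om b = 0) (hc : dynkinLabel om c = 0)
    (i : Fin l) : ⁅simpleRaise i, chainVector a b c v w (dynkinLabel nu a) (dynkinLabel nu b)
      (dynkinLabel nu c)⁆ = 0 := by
  obtain ⟨v1, v2, v3, v4⟩ := h.raise_string hl hv ha hb hc i
  have m : w ∈ weightSpace W nu := hw.1.2
  have e0 : ⁅simpleRaise i, w⁆ = 0 := hw.2 _ (isPositive_rootElt (raises_simple i))
  have ma := simpleLower_lie_mem hl m a
  have mb := simpleLower_lie_mem hl m b
  have mc := simpleLower_lie_mem hl m c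
  have mbc := simpleLower_lie_mem hl mc b
  have mcb := simpleLower_lie_mem hl mb c
  have mac := simpleLower_lie_mem hl mc a
  have mba := simpleLower_lie_mem hl ma b
  have ea := simpleRaise_lie_simpleLower_lie hl m i a
  have eb := simpleRaise_lie_simpleLower_lie hl m i b
  have ec := simpleRaise_lie_simpleLower_lie hl m i c
  have ebc := simpleRaise_lie_simpleLower_lie hl mc i b
  have ecb := simpleRaise_lie_simpleLower_lie hl mb i c
  have eac := simpleRaise_lie_simpleLower_lie hl mc i a
  have eba := simpleRaise_lie_simpleLower_lie hl ma i b
  have eabc := simpleRaise_lie_simpleLower_lie hl mbc i a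
  have eacb := simpleRaise_lie_simpleLower_lie hl mcb i a
  have ebac := simpleRaise_lie_simpleLower_lie hl mac i b
  have ecba := simpleRaise_lie_simpleLower_lie hl mba i c
  -- Formulas for short words are substituted into those for longer ones, so every raised word ends
  -- as a combination of lowering words.
  simp only [e0, lie_zero, zero_add] at ea eb ec
  rw [ea] at eba
  rw [eb] at ecb
  rw [ec] at ebc eac
  rw [ebc] at eabc
  rw [ecb] at eacb
  rw [eac] at ebac
  rw [eba] at ecba
  simp only [chainVector, lie_add, lie_sub, lie_smul, TensorProduct.LieModule.lie_tmul_right, v1,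
    v2, v3, v4, e0, ec, ebc, ecb, eabc, eacb, ebac, ecba]
  rcases eq_or_ne i a with hia | hia
  · subst hia
    simp only [if_neg h.a_ne_b, if_neg h.a_ne_c, if_true, dynkinLabel_sub, h.ba, h.ca, h.self]
    simp only [TensorProduct.tmul_add, TensorProduct.tmul_sub, TensorProduct.tmul_smul,
      ← TensorProduct.smul_tmul', TensorProduct.zero_tmul, TensorProduct.tmul_zero,
      zero_smul, smul_zero, add_zero, zero_add, h.lower_lie_lower]
    module
  rcases eq_or_ne i b with hib | hib
  · subst hib
    simp only [if_neg h.a_ne_b.symm, if_neg h.b_ne_c, if_true, dynkinLabel_sub, h.ab, h.cb, h.self]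
    simp only [TensorProduct.tmul_add, TensorProduct.tmul_sub, TensorProduct.tmul_smul,
      ← TensorProduct.smul_tmul', TensorProduct.zero_tmul, TensorProduct.tmul_zero,
      zero_smul, smul_zero, add_zero, zero_add, h.lower_lie_lower]
    module
  rcases eq_or_ne i c with hic | hic
  · subst hic
    simp only [if_neg h.a_ne_c.symm, if_neg h.b_ne_c.symm, if_true, dynkinLabel_sub, h.ac, h.bc,
      h.self]
    simp only [TensorProduct.tmul_add, TensorProduct.tmul_sub, TensorProduct.tmul_smul,
      ← TensorProduct.smul_tmul', TensorProduct.zero_tmul, TensorProduct.tmul_zero,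
      zero_smul, smul_zero, add_zero, zero_add, h.lower_lie_lower]
    module
  · simp [hia, hib, hic]

theorem chainVector_mem (hl : 2 ≤ l) {om nu : Fin l → ℂ} {v : V} {w : W}
    (hv : v ∈ weightSpace V om) (hw : w ∈ weightSpace W nu) (x y z : ℂ) :
    chainVector a b c v w x y z ∈ weightSpace (V ⊗[ℂ] W)
      (nu + (om - simpleCoroot l a - simpleCoroot l b - simpleCoroot l c)) := by
  have tm : ∀ {chi psi : Fin l → ℂ} {v : V} {w : W}, v ∈ weightSpace V chi →
      w ∈ weightSpace W psi → chi + psi =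
        nu + (om - simpleCoroot l a - simpleCoroot l b - simpleCoroot l c) →
      v ⊗ₜ[ℂ] w ∈ weightSpace (V ⊗[ℂ] W)
        (nu + (om - simpleCoroot l a - simpleCoroot l b - simpleCoroot l c)) := by
    intro chi psi v w h1 h2 h3
    rw [← h3]
    exact tmul_mem_weightSpace h1 h2
  have va := simpleLower_lie_mem hl hv a
  have vb := simpleLower_lie_mem hl va b
  have vc := simpleLower_lie_mem hl vb c
  have wa := simpleLower_lie_mem hl hw a
  have wb := simpleLower_lie_mem hl hw b
  have wc := simpleLower_lie_mem hl hw c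
  have wbc := simpleLower_lie_mem hl wc b
  have wcb := simpleLower_lie_mem hl wb c
  have wac := simpleLower_lie_mem hl wc a
  have wba := simpleLower_lie_mem hl wa b
  have wabc := simpleLower_lie_mem hl wbc a
  have wacb := simpleLower_lie_mem hl wcb a
  have wbac := simpleLower_lie_mem hl wac b
  have wcba := simpleLower_lie_mem hl wba c
  simp only [chainVector, TensorProduct.tmul_add, TensorProduct.tmul_sub, TensorProduct.tmul_smul]
  have k1 := tm vc hw (by abel)
  have k2 := tm vb wc (by abel)
  have k3 := tm va wbc (by abel)
  have k4 := tm va wcb (by abel)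
  have k5 := tm hv wabc (by abel)
  have k6 := tm hv wacb (by abel)
  have k7 := tm hv wbac (by abel)
  have k8 := tm hv wcba (by abel)
  set E := weightSpace (V ⊗[ℂ] W)
    (nu + (om - simpleCoroot l a - simpleCoroot l b - simpleCoroot l c))
  exact E.sub_mem (E.add_mem (E.sub_mem (E.smul_mem _ k1) (E.smul_mem _ k2))
    (E.smul_mem _ (E.sub_mem (E.smul_mem _ k3) (E.smul_mem _ k4))))
    (E.add_mem (E.sub_mem (E.sub_mem (E.smul_mem _ k5) (E.smul_mem _ k6)) (E.smul_mem _ k7))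
      (E.smul_mem _ k8))

/-- Raising by `c` in the first factor alone kills every summand but the first, leaving a pure
tensor whose coefficient is nonzero for natural labels with `z ≠ 0`. -/
theorem IsChain.chainVector_ne_zero [FiniteDimensional ℂ V]
    (hl : 2 ≤ l) (h : IsChain a b c) {om : Fin l → ℂ} {v : V} {w : W}
    (hv : IsHighestWeightVector om v) (hw : w ≠ 0)
    (ha : dynkinLabel om a = 1) (hb : dynkinLabel om b = 0) (hc : dynkinLabel om c = 0)
    (x y z : ℕ) (hz : z ≠ 0) : chainVector (l := l) a b c v w x y z ≠ 0 := by
  intro h0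
  obtain ⟨v1, v2, v3, v4⟩ := h.raise_string hl hv ha hb hc c
  rw [if_neg h.a_ne_c.symm, zero_smul] at v2
  rw [if_neg h.b_ne_c.symm, zero_smul] at v3
  rw [if_pos rfl, one_smul] at v4
  have h1 := congrArg
    ((LieModule.toEnd ℂ (SoEven l) V (simpleRaise c)).rTensor W) h0
  simp only [chainVector, map_add, map_sub, map_smul, LinearMap.rTensor_tmul,
    LieModule.toEnd_apply_apply, v1, v2, v3, v4, TensorProduct.zero_tmul, smul_zero, sub_zero,
    add_zero, map_zero, smul_eq_zero] at h1
  rcases h1 with h1 | h1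
  · have : ((z * (y + z + 1) * (x + y + z + 2) : ℕ) : ℂ) = 0 := by
      push_cast
      exact h1
    rw [Nat.cast_eq_zero] at this
    simp [hz] at this
  · exact tmul_ne_zero (h.string_ne_zero hl hv ha hb hc).1 hw h1

/-- The tensor product has a component of highest weight `ν + ω - α_a - α_b - α_c`. -/
theorem IsChain.exists_component (hl : 2 ≤ l) (h : IsChain a b c) {om nu : Fin l → ℂ}
    (hV : IsIrrep om V) (hW : IsIrrep nu W)
    (ha : dynkinLabel om a = 1) (hb : dynkinLabel om b = 0) (hc : dynkinLabel om c = 0)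
    (hnu : IsDominant nu) (hnc : dynkinLabel nu c ≠ 0) :
    ∃ N : LieSubmodule ℂ (SoEven l) (V ⊗[ℂ] W), IsIrrep
      (nu + (om - simpleCoroot l a - simpleCoroot l b - simpleCoroot l c)) N := by
  have := hV.finiteDimensional
  have := hW.finiteDimensional
  obtain ⟨v, hv⟩ := hV.highestWeight
  obtain ⟨w, hw⟩ := hW.highestWeight
  obtain ⟨x, hx⟩ := hnu a
  obtain ⟨y, hy⟩ := hnu b
  obtain ⟨z, hz⟩ := hnu c
  refine ⟨_, isIrrep_lieSpan (v := chainVector a b c v w (dynkinLabel nu a) (dynkinLabel nu b)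
    (dynkinLabel nu c)) ⟨⟨?_, ?_⟩, ?_⟩⟩
  · rw [hx, hy, hz]
    refine h.chainVector_ne_zero hl hv hw.1.1 ha hb hc x y z ?_
    rintro rfl
    exact hnc (by rw [hz, Nat.cast_zero])
  · exact chainVector_mem hl hv.1.2 hw.1.2 _ _ _
  · exact fun X hX => isPositive_lie_eq_zero_of_simple hl
      (h.raise_chainVector hl hv hw ha hb hc) hX

end Chains

/-! ### Models of the spin modules and of the modules needed for ν. -/

section Spinors

/-- The spinor space. -/
def Spinor (l : ℕ) : Type := ExteriorAlgebra ℂ (Fin l → ℂ)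

noncomputable instance (l : ℕ) : AddCommGroup (Spinor l) :=
  inferInstanceAs (AddCommGroup (ExteriorAlgebra ℂ (Fin l → ℂ)))

noncomputable instance (l : ℕ) : Module ℂ (Spinor l) :=
  inferInstanceAs (Module ℂ (ExteriorAlgebra ℂ (Fin l → ℂ)))

/-- Exterior powers above degree `l` vanish and the others are finite-dimensional. -/
theorem finite_exteriorAlgebra (l : ℕ) : Module.Finite ℂ (ExteriorAlgebra ℂ (Fin l → ℂ)) := by
  have h1 : (⨆ n : ℕ, ⋀[ℂ]^n (Fin l → ℂ)) = ⊤ :=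
    (DirectSum.Decomposition.isInternal fun n : ℕ => ⋀[ℂ]^n (Fin l → ℂ)).submodule_iSup_eq_top
  have h2 : ∀ n, l < n → ⋀[ℂ]^n (Fin l → ℂ) = ⊥ := by
    intro n hn
    rw [← Submodule.finrank_eq_zero (R := ℂ), exteriorPower.finrank_eq, Module.finrank_fin_fun,
      Nat.choose_eq_zero_of_lt hn]
  have h3 : (⨆ n : Fin (l + 1), ⋀[ℂ]^n.val (Fin l → ℂ)) = ⊤ := by
    rw [eq_top_iff, ← h1]
    refine iSup_le fun n => ?_
    by_cases hn : n < l + 1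
    · exact le_iSup (fun n : Fin (l + 1) => ⋀[ℂ]^n.val (Fin l → ℂ)) ⟨n, hn⟩
    · rw [h2 n (by omega)]
      exact bot_le
  rw [Module.finite_def, ← h3]
  exact Submodule.fg_iSup _ fun n => Module.Finite.iff_fg.mp inferInstance

instance (l : ℕ) : FiniteDimensional ℂ (Spinor l) := finite_exteriorAlgebra l

variable {l : ℕ}

/-- The annihilation operators (left block) and creation operators (right block). -/
noncomputable def gamma : Fin l ⊕ Fin l → Module.End ℂ (Spinor l)
  | Sum.inl i => CliffordAlgebra.contractLeft (Q := (0 : QuadraticForm ℂ (Fin l → ℂ)))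
      (LinearMap.proj i)
  | Sum.inr i => LinearMap.mulLeft ℂ (ExteriorAlgebra.ι ℂ (Pi.single i 1 : Fin l → ℂ))

theorem gamma_mul_gamma_add (p q : Fin l ⊕ Fin l) :
    gamma p * gamma q + gamma q * gamma p = if p = q.swap then 1 else 0 := by
  have h : ∀ i j : Fin l, gamma (Sum.inl i) * gamma (Sum.inr j) +
      gamma (Sum.inr j) * gamma (Sum.inl i) = if i = j then 1 else 0 := by
    intro i j
    refine LinearMap.ext fun x => ?_
    have := CliffordAlgebra.contractLeft_ι_mul (Q := (0 : QuadraticForm ℂ (Fin l → ℂ)))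
      (LinearMap.proj i) (Pi.single j 1) x
    have e : (gamma (Sum.inl i) * gamma (Sum.inr j)) x + (gamma (Sum.inr j) * gamma (Sum.inl i)) x
        = (LinearMap.proj i : Module.Dual ℂ (Fin l → ℂ)) (Pi.single j 1) • x :=
      eq_sub_iff_add_eq.mp this
    rw [LinearMap.add_apply, e]
    simp only [LinearMap.proj_apply, Pi.single_apply]
    split_ifs
    · exact one_smul ℂ x
    · exact zero_smul ℂ x
  rcases p with i | i <;> rcases q with j | j
  · rw [if_neg (by simp)]
    refine LinearMap.ext fun x => ?_
    have := CliffordAlgebra.contractLeft_comm (Q := (0 : QuadraticForm ℂ (Fin l → ℂ)))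
      (LinearMap.proj i) (LinearMap.proj j) x
    exact eq_neg_iff_add_eq_zero.mp this
  · rw [h]
    simp
  · rw [add_comm, h]
    simp [eq_comm]
  · rw [if_neg (by simp)]
    refine LinearMap.ext fun x => ?_
    have := ExteriorAlgebra.ι_add_mul_swap (R := ℂ) (Pi.single i 1 : Fin l → ℂ) (Pi.single j 1)
    have e : ∀ x : ExteriorAlgebra ℂ (Fin l → ℂ),
        ExteriorAlgebra.ι ℂ (Pi.single i 1) * (ExteriorAlgebra.ι ℂ (Pi.single j 1) * x) +
        ExteriorAlgebra.ι ℂ (Pi.single j 1) * (ExteriorAlgebra.ι ℂ (Pi.single i 1) * x) = 0 := by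
      intro x
      rw [← mul_assoc, ← mul_assoc, ← add_mul, this, zero_mul]
    exact e x

/-- The spin representation, as a linear map. -/
noncomputable def spinMap (X : SoEven l) : Module.End ℂ (Spinor l) :=
  ∑ p, ∑ q, ((1 / 2 : ℂ) * X.mat p q) • (gamma p * gamma q.swap)

/-- By the Clifford relations, the commutator of a product of two gammas with a third is linear in
gammas. Skewness of `X` makes the two resulting sums equal, absorbing the 1/2: the gammas transform
as the natural module. -/
theorem spinMap_mul_gamma (X : SoEven l) (r : Fin l ⊕ Fin l) :
    spinMap X * gamma r - gamma r * spinMap X = ∑ p, X.mat p r • gamma p := by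
  have h : ∀ p q : Fin l ⊕ Fin l, gamma p * gamma q.swap * gamma r - gamma r * (gamma p * gamma q.swap)
      = (if q = r then gamma p else 0) - (if r = p.swap then gamma q.swap else 0) := by
    intro p q
    have h1 := gamma_mul_gamma_add q.swap r
    have h2 := gamma_mul_gamma_add r p
    have h3 : gamma p * gamma q.swap * gamma r - gamma r * (gamma p * gamma q.swap) =
        gamma p * (gamma q.swap * gamma r + gamma r * gamma q.swap) -
          (gamma r * gamma p + gamma p * gamma r) * gamma q.swap := by noncomm_ring
    rw [h3, h1, h2]
    have e : (q.swap = r.swap) = (q = r) := by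
      rw [Sum.swap_leftInverse.injective.eq_iff]
    simp [e]
  have h4 : spinMap X * gamma r - gamma r * spinMap X =
      ∑ p, ∑ q, ((1 / 2 : ℂ) * X.mat p q) • ((if q = r then gamma p else 0) -
        (if r = p.swap then gamma q.swap else 0)) := by
    simp only [spinMap, Finset.sum_mul, Finset.mul_sum, ← Finset.sum_sub_distrib, ← h, smul_sub,
      smul_mul_assoc, mul_smul_comm]
  have e : ∀ p, (r = p.swap) = (p = r.swap) := fun p =>
    propext ⟨fun h => by simp [h], fun h => by simp [h]⟩
  rw [h4]
  simp only [smul_sub, Finset.sum_sub_distrib, smul_ite, smul_zero, Finset.sum_ite_eq',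
    Finset.mem_univ, if_true, e]
  rw [Finset.sum_comm (f := fun p q => if p = r.swap then
    ((1 / 2 : ℂ) * X.mat p q) • gamma q.swap else 0)]
  simp only [Finset.sum_ite_eq', Finset.mem_univ, if_true]
  rw [← sum_swap fun q => ((1 / 2 : ℂ) * X.mat r.swap q) • gamma q.swap, ← Finset.sum_sub_distrib]
  refine Finset.sum_congr rfl fun p _ => ?_
  rw [X.mat_swap_swap, Sum.swap_swap]
  module

/-- Commutation with `spinMap X` is a derivation acting on each gamma by the natural module, so it
turns the coefficient matrix `Y` into `XY - YX`; the sign of the second product comes from skewness.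
-/
theorem spinMap_lie (X Y : SoEven l) :
    spinMap ⁅X, Y⁆ = spinMap X * spinMap Y - spinMap Y * spinMap X := by
  have h1 : ∀ p q : Fin l ⊕ Fin l, spinMap X * (gamma p * gamma q.swap) -
      gamma p * gamma q.swap * spinMap X = ∑ r, X.mat r p • (gamma r * gamma q.swap) +
        ∑ r, X.mat r q.swap • (gamma p * gamma r) := by
    intro p q
    have h2 := spinMap_mul_gamma X p
    have h3 := spinMap_mul_gamma X q.swap
    have h4 : spinMap X * (gamma p * gamma q.swap) - gamma p * gamma q.swap * spinMap X =
        (spinMap X * gamma p - gamma p * spinMap X) * gamma q.swap +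
          gamma p * (spinMap X * gamma q.swap - gamma q.swap * spinMap X) := by noncomm_ring
    rw [h4, h2, h3, Finset.sum_mul, Finset.mul_sum]
    simp only [smul_mul_assoc, mul_smul_comm]
  have h5 : spinMap X * spinMap Y - spinMap Y * spinMap X =
      ∑ p, ∑ q, ((1 / 2 : ℂ) * Y.mat p q) • (∑ r, X.mat r p • (gamma r * gamma q.swap) +
        ∑ r, X.mat r q.swap • (gamma p * gamma r)) := by
    simp only [← h1, smul_sub]
    rw [spinMap.eq_1 Y]
    simp only [Finset.sum_mul, Finset.mul_sum, ← Finset.sum_sub_distrib, smul_mul_assoc,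
      mul_smul_comm]
  have h6 : ∑ p, ∑ q, ∑ r, ((1 / 2 : ℂ) * Y.mat p q) • X.mat r p • (gamma r * gamma q.swap) =
      ∑ p, ∑ q, ((1 / 2 : ℂ) * (X.mat * Y.mat) p q) • (gamma p * gamma q.swap) := by
    simp only [Matrix.mul_apply, Finset.mul_sum, Finset.sum_smul, smul_smul]
    calc _ = ∑ q : Fin l ⊕ Fin l, ∑ p, ∑ r, (1 / 2 * Y.mat p q * X.mat r p) •
          (gamma r * gamma q.swap) := Finset.sum_comm
      _ = ∑ q : Fin l ⊕ Fin l, ∑ r, ∑ p, (1 / 2 * Y.mat p q * X.mat r p) •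
          (gamma r * gamma q.swap) := Finset.sum_congr rfl fun _ _ => Finset.sum_comm
      _ = ∑ r, ∑ q : Fin l ⊕ Fin l, ∑ p, (1 / 2 * Y.mat p q * X.mat r p) •
          (gamma r * gamma q.swap) := Finset.sum_comm
      _ = _ := by
        refine Finset.sum_congr rfl fun _ _ => Finset.sum_congr rfl fun _ _ =>
          Finset.sum_congr rfl fun _ _ => ?_
        congr 1
        ring
  have h7 : ∑ p, ∑ q : Fin l ⊕ Fin l, ∑ r, ((1 / 2 : ℂ) * Y.mat p q) • X.mat r q.swap •
      (gamma p * gamma r) =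
      - ∑ p, ∑ q, ((1 / 2 : ℂ) * (Y.mat * X.mat) p q) • (gamma p * gamma q.swap) := by
    simp only [Matrix.mul_apply, Finset.mul_sum, Finset.sum_smul, smul_smul,
      ← Finset.sum_neg_distrib]
    refine Finset.sum_congr rfl fun p _ => ?_
    rw [Finset.sum_comm, ← sum_swap]
    refine Finset.sum_congr rfl fun r _ => Finset.sum_congr rfl fun q _ => ?_
    rw [X.mat_swap_swap]
    module
  rw [h5]
  simp only [smul_add, Finset.smul_sum, Finset.sum_add_distrib, h6, h7]
  simp only [spinMap, SoEven.mat_lie, Matrix.sub_apply, mul_sub, sub_smul, Finset.sum_sub_distrib]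
  abel

theorem spinMap_add (X Y : SoEven l) : spinMap (X + Y) = spinMap X + spinMap Y := by
  have : ∀ p q, (X + Y).mat p q = X.mat p q + Y.mat p q := fun p q => rfl
  simp only [spinMap, this, mul_add, add_smul, Finset.sum_add_distrib]

theorem spinMap_smul (c : ℂ) (X : SoEven l) : spinMap (c • X) = c • spinMap X := by
  have : ∀ p q, (c • X).mat p q = c * X.mat p q := fun p q => rfl
  simp only [spinMap, this, Finset.smul_sum, smul_smul]
  refine Finset.sum_congr rfl fun _ _ => Finset.sum_congr rfl fun _ _ => ?_
  congr 1
  ring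

noncomputable instance : LieRingModule (SoEven l) (Spinor l) where
  bracket X s := spinMap X s
  add_lie X Y s := by
    rw [spinMap_add, LinearMap.add_apply]
  lie_add X s t := map_add (spinMap X) s t
  leibniz_lie X Y s := by
    change spinMap X (spinMap Y s) = spinMap ⁅X, Y⁆ s + spinMap Y (spinMap X s)
    rw [spinMap_lie, LinearMap.sub_apply, Module.End.mul_apply, Module.End.mul_apply,
      sub_add_cancel]

theorem spinor_lie (X : SoEven l) (s : Spinor l) : ⁅X, s⁆ = spinMap X s := rfl

instance : LieModule ℂ (SoEven l) (Spinor l) where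
  smul_lie c X s := by rw [spinor_lie, spinor_lie, spinMap_smul, LinearMap.smul_apply]
  lie_smul c X s := map_smul (spinMap X) c s

theorem spinMap_rootElt (p q : Fin l ⊕ Fin l) :
    spinMap (rootElt p q) = (1 / 2 : ℂ) • (gamma p * gamma q.swap - gamma q.swap * gamma p) := by
  have h1 : ∀ r s : Fin l ⊕ Fin l, ∑ a, ∑ b, ((1 / 2 : ℂ) * (if a = r ∧ b = s then 1 else 0)) •
      (gamma a * gamma b.swap) = (1 / 2 : ℂ) • (gamma r * gamma s.swap) := by
    intro r s
    simp [ite_and]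
  simp only [spinMap, rootElt_mat_apply, mul_sub, sub_smul, Finset.sum_sub_distrib, h1,
    Sum.swap_swap, smul_sub]

/-- The vacuum vector. -/
noncomputable def vacuum (l : ℕ) : Spinor l := (1 : ExteriorAlgebra ℂ (Fin l → ℂ))

theorem gamma_vacuum (i : Fin l) : gamma (Sum.inl i) (vacuum l) = 0 :=
  CliffordAlgebra.contractLeft_one (Q := (0 : QuadraticForm ℂ (Fin l → ℂ))) (LinearMap.proj i)

theorem vacuum_ne_zero : vacuum l ≠ 0 := one_ne_zero (α := ExteriorAlgebra ℂ (Fin l → ℂ))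

theorem gamma_inl_inr (i j : Fin l) (s : Spinor l) : gamma (Sum.inl i) (gamma (Sum.inr j) s) =
    (if i = j then 1 else 0 : ℂ) • s - gamma (Sum.inr j) (gamma (Sum.inl i) s) := by
  have := LinearMap.congr_fun (gamma_mul_gamma_add (Sum.inl i) (Sum.inr j)) s
  rw [LinearMap.add_apply, Module.End.mul_apply, Module.End.mul_apply] at this
  rw [eq_sub_iff_add_eq, this]
  by_cases h : i = j <;> simp [h]

theorem isHighestWeightVector_of_spinor {lam : Fin l → ℂ} {s : Spinor l} (hs : s ≠ 0)
    (h0 : ∀ i, (1 / 2 : ℂ) • (gamma (Sum.inl i) (gamma (Sum.inr i) s) -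
      gamma (Sum.inr i) (gamma (Sum.inl i) s)) = lam i • s)
    (h1 : ∀ i j : Fin l, gamma (Sum.inl i) (gamma (Sum.inl j) s) = 0)
    (h2 : ∀ i j : Fin l, i < j → gamma (Sum.inl i) (gamma (Sum.inr j) s) = 0)
    (h3 : ∀ i j : Fin l, i < j → gamma (Sum.inr j) (gamma (Sum.inl i) s) = 0) :
    IsHighestWeightVector lam s := by
  refine ⟨⟨hs, mem_weightSpace_of_coord fun i => ?_⟩, fun X hX =>
    lie_eq_zero_of_isPositive (fun p q hpq => ?_) hX⟩
  · rw [← rootElt_self_eq_cartan, spinor_lie, spinMap_rootElt, ← h0]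
    rfl
  · rw [spinor_lie, spinMap_rootElt, LinearMap.smul_apply, LinearMap.sub_apply,
      Module.End.mul_apply, Module.End.mul_apply]
    rcases p with i | i <;> rcases q with j | j <;> simp only [Raises] at hpq
    · rw [Sum.swap_inl, h2 i j hpq, h3 i j hpq, sub_zero, smul_zero]
    · rw [Sum.swap_inr, h1, h1, sub_zero, smul_zero]
    · rw [Sum.swap_inr, h2 j i hpq, h3 j i hpq, sub_zero, smul_zero]

/-- Half the commutator of annihilation and creation at an index is `1/2` on the vacuum, so all
coordinates of the weight are `1/2`. -/
theorem isHighestWeightVector_vacuum (k : Fin l) (hk : k.val + 1 = l) :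
    IsHighestWeightVector (fundWeight l k) (vacuum l) := by
  refine isHighestWeightVector_of_spinor vacuum_ne_zero ?_ ?_ ?_ ?_
  · intro i
    have : fundWeight l k i = 1 / 2 := by
      simp only [fundWeight]
      split_ifs <;> first | omega | rfl
    rw [gamma_inl_inr, gamma_vacuum, map_zero, if_pos rfl, this]
    simp
  · intro i j
    rw [gamma_vacuum, map_zero]
  · intro i j hij
    rw [gamma_inl_inr, gamma_vacuum, map_zero, if_neg hij.ne]
    simp
  · intro i j hij
    rw [gamma_vacuum, map_zero]

/-- Creation at the last index `z` flips only the last sign. Raising operators still annihilate it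
because no index follows `z`. -/
theorem isHighestWeightVector_gamma_vacuum (k z : Fin l) (hk : k.val + 2 = l) (hz : z.val + 1 = l) :
    IsHighestWeightVector (fundWeight l k) (gamma (Sum.inr z) (vacuum l)) := by
  have hzz := gamma_inl_inr z z (vacuum l)
  rw [gamma_vacuum, map_zero, if_pos rfl, one_smul, sub_zero] at hzz
  have hg : ∀ i, gamma (Sum.inl i) (gamma (Sum.inr z) (vacuum l)) =
      (if i = z then 1 else 0 : ℂ) • vacuum l := by
    intro i
    rw [gamma_inl_inr, gamma_vacuum, map_zero, sub_zero]
  refine isHighestWeightVector_of_spinor ?_ ?_ ?_ ?_ ?_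
  · intro h
    rw [h, map_zero] at hzz
    exact vacuum_ne_zero hzz.symm
  · intro i
    have : fundWeight l k i = if i = z then - (1 / 2) else 1 / 2 := by
      have e : (i = z) = (i.val + 1 = l) := by
        rw [Fin.ext_iff]
        exact propext ⟨fun h => by omega, fun h => by omega⟩
      simp only [fundWeight, e]
      split_ifs <;> first | omega | rfl
    rw [gamma_inl_inr, hg, map_smul, if_pos rfl, this]
    by_cases h : i = z
    · subst h
      simp only [if_true]
      module
    · simp only [if_neg h]
      module
  · intro i j
    rw [hg, map_smul, gamma_vacuum, smul_zero]
  · intro i j hij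
    have : i ≠ z := fun h => by
      have := j.2
      rw [Fin.lt_def, h] at hij
      omega
    rw [gamma_inl_inr, hg, if_neg hij.ne, if_neg this]
    simp
  · intro i j hij
    have : i ≠ z := fun h => by
      have := j.2
      rw [Fin.lt_def, h] at hij
      omega
    rw [hg, if_neg this, zero_smul, map_zero]

/-- The product of the first `k` annihilation operators. -/
noncomputable def gammaProd (l : ℕ) : ℕ → Module.End ℂ (Spinor l)
  | 0 => 1
  -- The value 0 beyond `l` is a default; all uses have `k ≤ l`.
  | k + 1 => gammaProd l k * (if h : k < l then gamma (Sum.inl ⟨k, h⟩) else 0)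

theorem gammaProd_succ {k : ℕ} (h : k < l) :
    gammaProd l (k + 1) = gammaProd l k * gamma (Sum.inl ⟨k, h⟩) := by
  rw [gammaProd, dif_pos h]

theorem gamma_inl_mul (i j : Fin l) :
    gamma (Sum.inl i) * gamma (Sum.inl j) = - (gamma (Sum.inl j) * gamma (Sum.inl i)) := by
  have := gamma_mul_gamma_add (Sum.inl i) (Sum.inl j)
  rw [if_neg (by simp)] at this
  exact eq_neg_of_add_eq_zero_left this

theorem gammaProd_mul_gamma (k : ℕ) (hk : k ≤ l) (r : Fin l) (hr : r.val < k) :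
    gammaProd l k * gamma (Sum.inl r) = 0 := by
  induction k with
  | zero => omega
  | succ k ih =>
    rw [gammaProd_succ (by omega)]
    by_cases h : r.val < k
    · rw [mul_assoc, gamma_inl_mul, mul_neg, ← mul_assoc, ih (by omega) h, zero_mul, neg_zero]
    · have hr' : r = ⟨k, by omega⟩ := Fin.ext (by simp only; omega)
      have h2 := gamma_inl_mul r r
      have h3 : (2 : ℂ) • (gamma (Sum.inl r) * gamma (Sum.inl r)) = 0 := by
        rw [two_smul]
        nth_rewrite 1 [h2]
        exact neg_add_cancel _
      rw [← hr', mul_assoc, (smul_eq_zero.mp h3).resolve_left two_ne_zero, mul_zero]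

theorem lie_end_spinor (X : SoEven l) (f : Module.End ℂ (Spinor l)) :
    (⁅X, f⁆ : Module.End ℂ (Spinor l)) = spinMap X * f - f * spinMap X := by
  ext s
  exact LieHom.lie_apply f X s

theorem lie_mul_gamma (X : SoEven l) (f : Module.End ℂ (Spinor l)) (r : Fin l ⊕ Fin l) :
    (⁅X, f * gamma r⁆ : Module.End ℂ (Spinor l)) =
      ⁅X, f⁆ * gamma r + ∑ p, X.mat p r • (f * gamma p) := by
  have h : f * (spinMap X * gamma r - gamma r * spinMap X) = ∑ p, X.mat p r • (f * gamma p) := by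
    rw [spinMap_mul_gamma, Finset.mul_sum]
    simp only [mul_smul_comm]
  rw [lie_end_spinor, lie_end_spinor, ← h]
  noncomm_ring

/-- A positive element sends each annihilation operator to a combination of earlier ones. Those
already occur in the product, and anticommuting operators of square zero make it vanish. The product
thus plays the role of the highest weight vector of an exterior power, inside the endomorphisms of
the spinors. -/
theorem isPositive_lie_gammaProd {X : SoEven l} (hX : IsPositive X) (k : ℕ) (hk : k ≤ l) :
    (⁅X, gammaProd l k⁆ : Module.End ℂ (Spinor l)) = 0 := by
  induction k with
  | zero => rw [lie_end_spinor, gammaProd, mul_one, one_mul, sub_self]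
  | succ k ih =>
    rw [gammaProd_succ (by omega), lie_mul_gamma, ih (by omega), zero_mul, zero_add]
    refine Finset.sum_eq_zero fun p _ => ?_
    rcases p with p | p
    · by_cases h : p.val < k
      · rw [gammaProd_mul_gamma k (by omega) p h, smul_zero]
      · rw [hX.mat_eq_zero (by simp only [Raises, Fin.lt_def]; omega), zero_smul]
    · rw [hX.mat_eq_zero (by simp [Raises]), zero_smul]

theorem cartan_lie_gammaProd (t : Fin l → ℂ) (k : ℕ) (hk : k ≤ l) :
    (⁅cartan t, gammaProd l k⁆ : Module.End ℂ (Spinor l)) =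
      evalWeight (fun i => if i.val < k then 1 else 0) t • gammaProd l k := by
  induction k with
  | zero => simp [lie_end_spinor, gammaProd, evalWeight]
  | succ k ih =>
    have h1 : evalWeight (fun i : Fin l => if i.val < k + 1 then 1 else 0) t =
        evalWeight (fun i : Fin l => if i.val < k then 1 else 0) t + t ⟨k, by omega⟩ := by
      have e : (fun i : Fin l => if i.val < k + 1 then (1 : ℂ) else 0) =
          (fun i : Fin l => if i.val < k then 1 else 0) + Pi.single ⟨k, by omega⟩ 1 := by
        ext i
        simp only [Pi.add_apply, Pi.single_apply, Fin.ext_iff]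
        split_ifs <;> first | omega | simp
      rw [e, evalWeight_add, evalWeight_comm (Pi.single _ _), evalWeight_single]
    rw [gammaProd_succ (by omega), lie_mul_gamma, ih (by omega), h1, cartan_mat, add_smul,
      smul_mul_assoc]
    congr 1
    simp [Matrix.diagonal_apply, ite_smul, signed, -Fintype.sum_sum_type]

/-- Creating the indices one at a time builds a spinor that the product annihilates down to the
vacuum; the induction also needs the later annihilation operators to kill it. -/
theorem gammaProd_ne_zero (k : ℕ) (hk : k ≤ l) : gammaProd l k ≠ 0 := by
  have h : ∃ s : Spinor l, gammaProd l k s = vacuum l ∧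
      ∀ r : Fin l, k ≤ r.val → gamma (Sum.inl r) s = 0 := by
    induction k with
    | zero => exact ⟨vacuum l, rfl, fun r _ => gamma_vacuum r⟩
    | succ k ih =>
      obtain ⟨s, h1, h2⟩ := ih (by omega)
      refine ⟨gamma (Sum.inr ⟨k, by omega⟩) s, ?_, fun r hr => ?_⟩
      · rw [gammaProd_succ (by omega), Module.End.mul_apply, gamma_inl_inr, h2 _ le_rfl, map_zero,
          if_pos rfl, one_smul, sub_zero, h1]
      · have : r ≠ ⟨k, by omega⟩ := fun h => by
          rw [h] at hr
          simp only at hr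
          omega
        rw [gamma_inl_inr, h2 r (by omega), map_zero, if_neg this, zero_smul, sub_zero]
  obtain ⟨s, hs, -⟩ := h
  intro h0
  rw [h0, LinearMap.zero_apply] at hs
  exact vacuum_ne_zero hs.symm

theorem isHighestWeightVector_gammaProd (k : Fin l) (hk : k.val + 2 < l) :
    IsHighestWeightVector (fundWeight l k) (gammaProd l (k.val + 1)) := by
  refine ⟨⟨gammaProd_ne_zero _ (by omega), fun t => ?_⟩, fun X hX =>
    isPositive_lie_gammaProd hX _ (by omega)⟩
  rw [cartan_lie_gammaProd t _ (by omega)]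
  congr 2
  ext i
  simp only [fundWeight, hk, if_true, Fin.le_def, Nat.lt_succ_iff]

theorem IsHighestWeightVector.tmul {V W : Type*}
    [AddCommGroup V] [Module ℂ V] [LieRingModule (SoEven l) V] [LieModule ℂ (SoEven l) V]
    [AddCommGroup W] [Module ℂ W] [LieRingModule (SoEven l) W] [LieModule ℂ (SoEven l) W]
    {lam mu : Fin l → ℂ} {v : V} {w : W} (hv : IsHighestWeightVector lam v)
    (hw : IsHighestWeightVector mu w) : IsHighestWeightVector (lam + mu) (v ⊗ₜ[ℂ] w) := by
  refine ⟨⟨tmul_ne_zero hv.1.1 hw.1.1, tmul_mem_weightSpace hv.1.2 hw.1.2⟩, fun X hX => ?_⟩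
  rw [TensorProduct.LieModule.lie_tmul_right, hv.2 X hX, hw.2 X hX, TensorProduct.zero_tmul,
    TensorProduct.tmul_zero, add_zero]

/-- The spin modules exist. -/
theorem exists_spinor (hl : 2 ≤ l) (k : Fin l) (hk : k.val = l - 2 ∨ k.val = l - 1) :
    ∃ s : Spinor l, IsHighestWeightVector (fundWeight l k) s := by
  rcases hk with hk | hk
  · exact ⟨_, isHighestWeightVector_gamma_vacuum k ⟨l - 1, by omega⟩ (by omega)
      (by simp only; omega)⟩
  · exact ⟨_, isHighestWeightVector_vacuum k (by omega)⟩

theorem irrepExists_spin (hl : 2 ≤ l) (k : Fin l) (hk : k.val = l - 2 ∨ k.val = l - 1) :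
    IrrepExists (fundWeight l k) := by
  obtain ⟨s, hs⟩ := exists_spinor hl k hk
  exact irrepExists_of_highestWeightVector hs

theorem irrepExists_add_spin (hl : 2 ≤ l) (j k : Fin l) (hj : j.val + 2 < l)
    (hk : k.val = l - 2 ∨ k.val = l - 1) : IrrepExists (fundWeight l j + fundWeight l k) := by
  obtain ⟨s, hs⟩ := exists_spinor hl k hk
  exact irrepExists_of_highestWeightVector ((isHighestWeightVector_gammaProd j hj).tmul hs)

end Spinors

/-! ### The end of the D-type diagram and the comparison of eigenvalues. -/

section DynkinDiagram

variable {l : ℕ}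

theorem dynkinLabel_weightOfLabels (hl : 2 ≤ l) (a : Fin l → ℕ) (j : Fin l) :
    dynkinLabel (weightOfLabels a) j = a j := by
  have h : ∀ k, (a k : ℂ) • fundWeight l k = fun i => (a k : ℂ) * fundWeight l k i := fun k => rfl
  have : dynkinLabel (weightOfLabels a) j = ∑ k, (a k : ℂ) * dynkinLabel (fundWeight l k) j := by
    simp only [dynkinLabel, evalWeight, weightOfLabels, Finset.sum_apply, Pi.smul_apply,
      smul_eq_mul, Finset.sum_mul, Finset.mul_sum, mul_assoc]
    exact Finset.sum_comm
  rw [this]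
  simp [dynkinLabel_fundWeight hl]

theorem isDominant_weightOfLabels (hl : 2 ≤ l) (a : Fin l → ℕ) :
    IsDominant (weightOfLabels a) := fun j => ⟨a j, dynkinLabel_weightOfLabels hl a j⟩

theorem dynkinLabel_simpleCoroot_self (hl : 2 ≤ l) (i : Fin l) :
    dynkinLabel (simpleCoroot l i) i = 2 := by
  by_cases hi : i.val + 1 < l
  · rw [dynkinLabel_eq_of_lt _ _ hi]
    simp only [simpleCoroot, Fin.ext_iff]
    split_ifs <;> first | omega | norm_num
  · have hi' : i = ⟨l - 1, by omega⟩ := Fin.ext (by simp only; omega)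
    rw [hi', dynkinLabel_last _ hl]
    simp only [simpleCoroot, Fin.ext_iff]
    split_ifs <;> first | omega | tauto | norm_num

/-- The sum of two unlinked simple roots is not a root. The last hypothesis excludes the edge from
the branch node to the last node; the two spin nodes, consecutive but unlinked, are treated
separately. -/
theorem simpleLower_lie_eq_zero {i j : Fin l} (hi : i.val + 1 < l)
    (hij' : i.val ≠ j.val + 1) (hji' : j.val ≠ i.val + 1)
    (hij2 : j.val + 1 = l → i.val + 2 ≠ j.val) :
    ⁅(simpleLower i : SoEven l), simpleLower j⁆ = 0 := by
  rw [simpleLower, simpleLower, rootElt_lie_rootElt, simpleFst_of_lt hi, simpleSnd_of_lt hi]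
  by_cases hj : j.val + 1 < l
  · rw [simpleFst_of_lt hj, simpleSnd_of_lt hj]
    simp [Fin.ext_iff, hij', hji']
  · rw [simpleFst_of_not_lt hj, simpleSnd_of_not_lt hj]
    have := j.2
    have h1 := hij2 (by omega)
    simp only [Sum.swap_inl, Sum.inl.injEq, Sum.inr.injEq, reduceCtorEq, if_false,
      Fin.ext_iff]
    have h2 : ¬ j.val - 1 = i.val + 1 := by omega
    rw [if_neg h2, if_neg hji']
    simp

theorem simpleLower_lie_last (hl : 2 ≤ l) : ⁅(simpleLower (⟨l - 2, by omega⟩ : Fin l) : SoEven l),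
    simpleLower (⟨l - 1, by omega⟩ : Fin l)⁆ = 0 := by
  have hi : (⟨l - 2, by omega⟩ : Fin l).val + 1 < l := by simp only; omega
  have hj : ¬ (⟨l - 1, by omega⟩ : Fin l).val + 1 < l := by simp only; omega
  have hz : ∀ r : Fin l, rootElt (Sum.inr r) (Sum.inl r) = 0 := fun r =>
    rootElt_self_swap (Sum.inr r)
  rw [simpleLower, simpleLower, rootElt_lie_rootElt, simpleFst_of_lt hi, simpleSnd_of_lt hi,
    simpleFst_of_not_lt hj, simpleSnd_of_not_lt hj]
  have h2 : l - 1 - 1 = l - 2 := by omega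
  simp [Fin.ext_iff, h2, hz]

theorem two_le_of_four_le (hl : 4 ≤ l) : 2 ≤ l := le_trans (by norm_num) hl

theorem sub_lt_of_four_le (hl : 4 ≤ l) {k : ℕ} (hk : 0 < k) : l - k < l :=
  Nat.sub_lt (lt_of_lt_of_le (by norm_num) hl) hk

/-- Node `l - 4` (zero-based) of the Dynkin diagram. -/
def nodeA (hl : 4 ≤ l) : Fin l := ⟨l - 4, sub_lt_of_four_le hl (by norm_num)⟩

/-- The branch node. -/
def nodeB (hl : 4 ≤ l) : Fin l := ⟨l - 3, sub_lt_of_four_le hl (by norm_num)⟩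

/-- The node of the first spin module. -/
def nodeC (hl : 4 ≤ l) : Fin l := ⟨l - 2, sub_lt_of_four_le hl (by norm_num)⟩

/-- The node of the second spin module. -/
def nodeD (hl : 4 ≤ l) : Fin l := ⟨l - 1, sub_lt_of_four_le hl (by norm_num)⟩

theorem dynkinLabel_nodeA (hl : 4 ≤ l) (x : Fin l → ℂ) :
    dynkinLabel x (nodeA hl) = x (nodeA hl) - x (nodeB hl) := by
  rw [dynkinLabel_eq_of_lt x (nodeA hl) (by simp only [nodeA]; omega)]
  congr 2
  exact Fin.ext (by simp only [nodeA, nodeB]; omega)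

theorem dynkinLabel_nodeB (hl : 4 ≤ l) (x : Fin l → ℂ) :
    dynkinLabel x (nodeB hl) = x (nodeB hl) - x (nodeC hl) := by
  rw [dynkinLabel_eq_of_lt x (nodeB hl) (by simp only [nodeB]; omega)]
  congr 2
  exact Fin.ext (by simp only [nodeB, nodeC]; omega)

theorem dynkinLabel_nodeC (hl : 4 ≤ l) (x : Fin l → ℂ) :
    dynkinLabel x (nodeC hl) = x (nodeC hl) - x (nodeD hl) := by
  rw [dynkinLabel_eq_of_lt x (nodeC hl) (by simp only [nodeC]; omega)]
  congr 2
  exact Fin.ext (by simp only [nodeC, nodeD]; omega)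

theorem dynkinLabel_nodeD (hl : 4 ≤ l) (x : Fin l → ℂ) :
    dynkinLabel x (nodeD hl) = x (nodeC hl) + x (nodeD hl) :=
  dynkinLabel_last x (two_le_of_four_le hl)

theorem simpleCoroot_nodeA (hl : 4 ≤ l) :
    simpleCoroot l (nodeA hl) = Pi.single (nodeA hl) 1 - Pi.single (nodeB hl) 1 := by
  have e : l - 4 + 1 = l - 3 := by omega
  have e' : l - 3 < l := sub_lt_of_four_le hl (by norm_num)
  ext i
  simp only [simpleCoroot, Pi.sub_apply, Pi.single_apply, Fin.ext_iff, nodeA, nodeB, e, if_pos e']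
  split_ifs <;> first | omega | norm_num

theorem simpleCoroot_nodeB (hl : 4 ≤ l) :
    simpleCoroot l (nodeB hl) = Pi.single (nodeB hl) 1 - Pi.single (nodeC hl) 1 := by
  have e : l - 3 + 1 = l - 2 := by omega
  have e' : l - 2 < l := sub_lt_of_four_le hl (by norm_num)
  ext i
  simp only [simpleCoroot, Pi.sub_apply, Pi.single_apply, Fin.ext_iff, nodeC, nodeB, e, if_pos e']
  split_ifs <;> first | omega | norm_num

theorem simpleCoroot_nodeC (hl : 4 ≤ l) :
    simpleCoroot l (nodeC hl) = Pi.single (nodeC hl) 1 - Pi.single (nodeD hl) 1 := by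
  have e : l - 2 + 1 = l - 1 := by omega
  have e' : l - 1 < l := sub_lt_of_four_le hl (by norm_num)
  ext i
  simp only [simpleCoroot, Pi.sub_apply, Pi.single_apply, Fin.ext_iff, nodeC, nodeD, e, if_pos e']
  split_ifs <;> first | omega | norm_num

theorem simpleCoroot_nodeD (hl : 4 ≤ l) :
    simpleCoroot l (nodeD hl) = Pi.single (nodeC hl) 1 + Pi.single (nodeD hl) 1 := by
  have e' : ¬ l - 1 + 1 < l := by omega
  ext i
  simp only [simpleCoroot, Pi.add_apply, Pi.single_apply, Fin.ext_iff, nodeC, nodeD, if_neg e']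
  split_ifs <;> first | omega | norm_num

theorem nodes_ne (hl : 4 ≤ l) : nodeA hl ≠ nodeB hl ∧ nodeA hl ≠ nodeC hl ∧ nodeA hl ≠ nodeD hl ∧
    nodeB hl ≠ nodeC hl ∧ nodeB hl ≠ nodeD hl ∧ nodeC hl ≠ nodeD hl := by
  simp only [nodeA, nodeB, nodeC, nodeD, ne_eq, Fin.ext_iff]
  omega

/-- From each spin node two chains leave through the branch node, one to the other spin node and one
to node A. They produce the weights ε and η respectively. -/
theorem isChain_CBD (hl : 4 ≤ l) : IsChain (nodeC hl) (nodeB hl) (nodeD hl) := by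
  obtain ⟨h1, h2, h3, h4, h5, h6⟩ := nodes_ne hl
  refine ⟨h4.symm, h5, h6, dynkinLabel_simpleCoroot_self (two_le_of_four_le hl), ?_, ?_, ?_, ?_,
    ?_, ?_, simpleLower_lie_last (two_le_of_four_le hl)⟩ <;>
  simp [dynkinLabel_nodeB, dynkinLabel_nodeC, dynkinLabel_nodeD, simpleCoroot_nodeB,
    simpleCoroot_nodeC, simpleCoroot_nodeD, h4, h5, h6, h4.symm, h5.symm, h6.symm]

theorem isChain_DBC (hl : 4 ≤ l) : IsChain (nodeD hl) (nodeB hl) (nodeC hl) := by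
  have h := isChain_CBD hl
  refine ⟨h.b_ne_c.symm, h.a_ne_b.symm, h.a_ne_c.symm, h.self, h.cb, h.bc, h.ba, h.ab, h.ca, h.ac,
    ?_⟩
  rw [← lie_skew, h.lower_comm, neg_zero]

theorem isChain_CBA (hl : 4 ≤ l) : IsChain (nodeC hl) (nodeB hl) (nodeA hl) := by
  obtain ⟨h1, h2, h3, h4, h5, h6⟩ := nodes_ne hl
  refine ⟨h4.symm, h1.symm, h2.symm, dynkinLabel_simpleCoroot_self (two_le_of_four_le hl), ?_, ?_, ?_, ?_,
    ?_, ?_, simpleLower_lie_eq_zero ?_ ?_ ?_ ?_⟩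
  on_goal 7 => simp only [nodeC]; omega
  on_goal 7 => simp only [nodeC, nodeA]; omega
  on_goal 7 => simp only [nodeC, nodeA]; omega
  on_goal 7 => simp only [nodeC, nodeA]; omega
  all_goals
    simp [dynkinLabel_nodeA, dynkinLabel_nodeB, dynkinLabel_nodeC, simpleCoroot_nodeA,
      simpleCoroot_nodeB, simpleCoroot_nodeC, h1, h2, h3, h4, h5, h6, h1.symm,
      h2.symm, h3.symm, h4.symm, h5.symm, h6.symm]

theorem isChain_DBA (hl : 4 ≤ l) : IsChain (nodeD hl) (nodeB hl) (nodeA hl) := by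
  obtain ⟨h1, h2, h3, h4, h5, h6⟩ := nodes_ne hl
  have hc : ⁅(simpleLower (nodeA hl) : SoEven l), simpleLower (nodeD hl)⁆ = 0 := by
    refine simpleLower_lie_eq_zero ?_ ?_ ?_ ?_ <;> simp only [nodeA, nodeD] <;> omega
  refine ⟨h5.symm, h1.symm, h3.symm, dynkinLabel_simpleCoroot_self (two_le_of_four_le hl), ?_, ?_, ?_, ?_,
    ?_, ?_, by rw [← lie_skew, hc, neg_zero]⟩ <;>
  simp [dynkinLabel_nodeA, dynkinLabel_nodeB, dynkinLabel_nodeD, simpleCoroot_nodeA,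
    simpleCoroot_nodeB, simpleCoroot_nodeD, h1, h2, h3, h4, h5, h6, h1.symm,
    h2.symm, h3.symm, h4.symm, h5.symm, h6.symm]

theorem spinWeight_sub (hl : 4 ≤ l) (s₁ s₂ s₃ s₄ r₁ r₂ r₃ r₄ : ℂ) :
    spinWeight l s₁ s₂ s₃ s₄ - spinWeight l r₁ r₂ r₃ r₄ =
      ((s₁ - r₁) / 2) • Pi.single (nodeA hl) 1 + ((s₂ - r₂) / 2) • Pi.single (nodeB hl) 1
      + ((s₃ - r₃) / 2) • Pi.single (nodeC hl) 1 + ((s₄ - r₄) / 2) • Pi.single (nodeD hl) 1 := by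
  ext i
  simp only [spinWeight, Pi.sub_apply, Pi.add_apply, Pi.smul_apply, Pi.single_apply, Fin.ext_iff,
    nodeA, nodeB, nodeC, nodeD, smul_eq_mul]
  split_ifs <;> first | omega | ring

theorem fundWeight_nodeC (hl : 4 ≤ l) : fundWeight l (nodeC hl) = spinWeight l 1 1 1 (-1) := by
  ext i
  rw [fundWeight, if_neg (by simp only [nodeC]; omega), if_pos (by simp only [nodeC]; omega)]
  simp only [spinWeight]
  split_ifs <;> first | omega | norm_num

theorem fundWeight_nodeD (hl : 4 ≤ l) : fundWeight l (nodeD hl) = spinWeight l 1 1 1 1 := by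
  ext i
  rw [fundWeight, if_neg (by simp only [nodeD]; omega), if_neg (by simp only [nodeD]; omega)]
  simp only [spinWeight]
  split_ifs <;> first | omega | norm_num

/-- In signs on the last four coordinates, the successive subtractions read `(+,+,+,-)`,
`(+,+,-,+)`, `(+,-,+,+)`, `(+,-,-,-)`; ending with node A instead gives `(-,+,+,+)`. -/
theorem string_weight_CBD (hl : 4 ≤ l) :
    fundWeight l (nodeC hl) - simpleCoroot l (nodeC hl) - simpleCoroot l (nodeB hl)
      - simpleCoroot l (nodeD hl) = spinWeight l 1 (-1) (-1) (-1) := by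
  have h := spinWeight_sub hl 1 1 1 (-1) 1 (-1) (-1) (-1)
  rw [sub_eq_iff_eq_add] at h
  rw [fundWeight_nodeC, h, simpleCoroot_nodeB, simpleCoroot_nodeC, simpleCoroot_nodeD]
  module

theorem string_weight_CBA (hl : 4 ≤ l) :
    fundWeight l (nodeC hl) - simpleCoroot l (nodeC hl) - simpleCoroot l (nodeB hl)
      - simpleCoroot l (nodeA hl) = spinWeight l (-1) 1 1 1 := by
  have h := spinWeight_sub hl 1 1 1 (-1) (-1) 1 1 1
  rw [sub_eq_iff_eq_add] at h
  rw [fundWeight_nodeC, h, simpleCoroot_nodeB, simpleCoroot_nodeC, simpleCoroot_nodeA]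
  module

theorem string_weight_DBC (hl : 4 ≤ l) :
    fundWeight l (nodeD hl) - simpleCoroot l (nodeD hl) - simpleCoroot l (nodeB hl)
      - simpleCoroot l (nodeC hl) = spinWeight l 1 (-1) (-1) 1 := by
  have h := spinWeight_sub hl 1 1 1 1 1 (-1) (-1) 1
  rw [sub_eq_iff_eq_add] at h
  rw [fundWeight_nodeD, h, simpleCoroot_nodeB, simpleCoroot_nodeC, simpleCoroot_nodeD]
  module

theorem string_weight_DBA (hl : 4 ≤ l) :
    fundWeight l (nodeD hl) - simpleCoroot l (nodeD hl) - simpleCoroot l (nodeB hl)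
      - simpleCoroot l (nodeA hl) = spinWeight l (-1) 1 1 (-1) := by
  have h := spinWeight_sub hl 1 1 1 1 (-1) 1 1 (-1)
  rw [sub_eq_iff_eq_add] at h
  rw [fundWeight_nodeD, h, simpleCoroot_nodeB, simpleCoroot_nodeD, simpleCoroot_nodeA]
  module

/-- If ν had label 0 at `c`, the shifted weight would have label `0 + 1 - 2 = -1` there. -/
theorem IsChain.label_ne_zero {a b c : Fin l} (h : IsChain a b c) {om nu : Fin l → ℂ}
    (hc : dynkinLabel om c = 0) (hd : IsDominant
      (nu + (om - simpleCoroot l a - simpleCoroot l b - simpleCoroot l c))) :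
    dynkinLabel nu c ≠ 0 := by
  intro h0
  obtain ⟨n, hn⟩ := hd c
  simp only [dynkinLabel_add, dynkinLabel_sub, h0, hc, h.ac, h.bc, h.self] at hn
  have : ((n + 1 : ℕ) : ℂ) = 0 := by
    push_cast
    linear_combination -hn
  rw [Nat.cast_eq_zero] at this
  omega

/-- The difference of the quadratic expressions is `(e - f, 2ν + e + f + 2ρ)`, and `e - f` is `(1,
-1, -1, s)` on the last four coordinates and zero elsewhere. There `e + f` vanishes and ρ
contributes `3 - 2 - 1 + 0 = 0`. -/
theorem evalWeight_energy_sub (hl : 4 ≤ l) (nu : Fin l → ℂ) (s : ℂ) :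
    evalWeight (nu + spinWeight l 1 (-1) (-1) s) (nu + spinWeight l 1 (-1) (-1) s + (2 : ℂ) • rho l)
    - evalWeight (nu + spinWeight l (-1) 1 1 (-s))
      (nu + spinWeight l (-1) 1 1 (-s) + (2 : ℂ) • rho l) =
    2 * (nu (nodeA hl) - nu (nodeB hl) - nu (nodeC hl) + s * nu (nodeD hl)) := by
  set e := spinWeight l 1 (-1) (-1) s with he
  set f := spinWeight l (-1) 1 1 (-s) with hf
  have h1 : evalWeight (nu + e) (nu + e + (2 : ℂ) • rho l) -
      evalWeight (nu + f) (nu + f + (2 : ℂ) • rho l) =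
      evalWeight (nu + nu + e + f + (2 : ℂ) • rho l) (e - f) := by
    simp only [evalWeight, ← Finset.sum_sub_distrib]
    refine Finset.sum_congr rfl fun i _ => ?_
    simp only [Pi.add_apply, Pi.sub_apply, Pi.smul_apply, smul_eq_mul]
    ring
  have hA : e (nodeA hl) + f (nodeA hl) = 0 := by
    simp only [he, hf, spinWeight, nodeA]
    split_ifs <;> first | omega | ring
  have hB : e (nodeB hl) + f (nodeB hl) = 0 := by
    simp only [he, hf, spinWeight, nodeB]
    split_ifs <;> first | omega | ring
  have hC : e (nodeC hl) + f (nodeC hl) = 0 := by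
    simp only [he, hf, spinWeight, nodeC]
    split_ifs <;> first | omega | ring
  have hD : e (nodeD hl) + f (nodeD hl) = 0 := by
    simp only [he, hf, spinWeight, nodeD]
    split_ifs <;> first | omega | ring
  have rA : rho l (nodeA hl) = 3 := by
    simp only [rho, nodeA, Nat.cast_sub hl]
    push_cast; ring
  have rB : rho l (nodeB hl) = 2 := by
    simp only [rho, nodeB, Nat.cast_sub (show 3 ≤ l by omega)]
    push_cast; ring
  have rC : rho l (nodeC hl) = 1 := by
    simp only [rho, nodeC, Nat.cast_sub (two_le_of_four_le hl)]
    push_cast; ring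
  have rD : rho l (nodeD hl) = 0 := by
    simp only [rho, nodeD, Nat.cast_sub (show 1 ≤ l by omega)]
    push_cast; ring
  rw [h1, evalWeight_comm, he, hf, spinWeight_sub hl, ← he, ← hf]
  simp only [evalWeight_add, evalWeight_smul, evalWeight_comm (Pi.single _ _), evalWeight_single,
    Pi.add_apply, Pi.smul_apply, smul_eq_mul, rA, rB, rC, rD]
  linear_combination hA - hB - hC + s * hD

/-- For `s = -1` the linear form is the label at A minus the label at D; for `s = 1` it is the label
at A minus the label at C. -/
theorem mScalar_eq_iff (hl : 4 ≤ l) (om nu : Fin l → ℂ) (s : ℂ) :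
    mScalar om nu (nu + spinWeight l 1 (-1) (-1) s) =
      mScalar om nu (nu + spinWeight l (-1) 1 1 (-s)) ↔
    nu (nodeA hl) - nu (nodeB hl) - nu (nodeC hl) + s * nu (nodeD hl) = 0 := by
  have h := evalWeight_energy_sub hl nu s
  have hl0 : (4 * (2 * l - 2) : ℂ)⁻¹ ≠ 0 := by
    refine inv_ne_zero (mul_ne_zero (by norm_num) fun h => ?_)
    have h1 : (l : ℂ) = ((1 : ℕ) : ℂ) := by push_cast; linear_combination h / 2
    have : l = 1 := Nat.cast_injective h1
    omega
  rw [mScalar, mScalar, mul_right_inj' hl0]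
  constructor
  · intro h1
    linear_combination (h1 - h) / 2
  · intro h1
    linear_combination h + 2 * h1

theorem spinWeight_ne (hl : 4 ≤ l) (nu : Fin l → ℂ) (s : ℂ) :
    nu + spinWeight l 1 (-1) (-1) s ≠ nu + spinWeight l (-1) 1 1 (-s) := by
  intro h
  have h1 := congrFun (add_left_cancel h) (nodeA hl)
  have h2 : (nodeA hl).val + 4 = l := by simp only [nodeA]; omega
  have h3 : ¬ (nodeA hl).val + 4 < l := by omega
  simp only [spinWeight, if_neg h3, if_pos h2] at h1
  norm_num at h1

end DynkinDiagram

/-! ### The two components for each spin module. -/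

section Components

variable {l : ℕ} {V W : Type*}
  [AddCommGroup V] [Module ℂ V] [LieRingModule (SoEven l) V] [LieModule ℂ (SoEven l) V]
  [AddCommGroup W] [Module ℂ W] [LieRingModule (SoEven l) W] [LieModule ℂ (SoEven l) W]

/-- The hypotheses are nonzero labels at the ends of the two chains, so the same statement serves
the explicit ν of the first claim and the dominance hypotheses of the second. -/
theorem exists_components_nodeC (hl : 4 ≤ l) {a : Fin l → ℕ}
    (hV : IsIrrep (fundWeight l (nodeC hl)) V) (hW : IsIrrep (weightOfLabels a) W)
    (hA : dynkinLabel (weightOfLabels a) (nodeA hl) ≠ 0)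
    (hD : dynkinLabel (weightOfLabels a) (nodeD hl) ≠ 0) :
    ∃ (N N' : LieSubmodule ℂ (SoEven l) (V ⊗[ℂ] W)) (c c' : ℂ),
      IsComponentWithMEigenvalue (two_le_of_four_le hl)
        (weightOfLabels a + spinWeight l 1 (-1) (-1) (-1)) N c ∧
      IsComponentWithMEigenvalue (two_le_of_four_le hl)
        (weightOfLabels a + spinWeight l (-1) 1 1 1) N' c' ∧
      (c = c' ↔ a (nodeA hl) = a (nodeD hl)) := by
  have hl2 : 2 ≤ l := two_le_of_four_le hl
  obtain ⟨h1, h2, h3, h4, h5, h6⟩ := nodes_ne hl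
  have hdom := isDominant_weightOfLabels hl2 a
  obtain ⟨N, hN⟩ := (isChain_CBD hl).exists_component hl2 hV hW
    (by rw [dynkinLabel_fundWeight hl2, if_pos rfl])
    (by rw [dynkinLabel_fundWeight hl2, if_neg h4])
    (by rw [dynkinLabel_fundWeight hl2, if_neg h6.symm]) hdom hD
  obtain ⟨N', hN'⟩ := (isChain_CBA hl).exists_component hl2 hV hW
    (by rw [dynkinLabel_fundWeight hl2, if_pos rfl])
    (by rw [dynkinLabel_fundWeight hl2, if_neg h4])
    (by rw [dynkinLabel_fundWeight hl2, if_neg h2]) hdom hA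
  rw [string_weight_CBD] at hN
  rw [string_weight_CBA] at hN'
  refine ⟨N, N', _, _, isComponentWithMEigenvalue hl2 hV hW hN,
    isComponentWithMEigenvalue hl2 hV hW hN', ?_⟩
  have key := mScalar_eq_iff hl (fundWeight l (nodeC hl)) (weightOfLabels a) (-1)
  rw [neg_neg] at key
  have e1 := dynkinLabel_weightOfLabels hl2 a (nodeA hl)
  have e2 := dynkinLabel_weightOfLabels hl2 a (nodeD hl)
  rw [dynkinLabel_nodeA] at e1
  rw [dynkinLabel_nodeD] at e2
  rw [key, ← Nat.cast_inj (R := ℂ), ← e1, ← e2]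
  constructor <;> intro h <;> linear_combination h

theorem exists_components_nodeD (hl : 4 ≤ l) {a : Fin l → ℕ}
    (hV : IsIrrep (fundWeight l (nodeD hl)) V) (hW : IsIrrep (weightOfLabels a) W)
    (hA : dynkinLabel (weightOfLabels a) (nodeA hl) ≠ 0)
    (hC : dynkinLabel (weightOfLabels a) (nodeC hl) ≠ 0) :
    ∃ (N N' : LieSubmodule ℂ (SoEven l) (V ⊗[ℂ] W)) (c c' : ℂ),
      IsComponentWithMEigenvalue (two_le_of_four_le hl)
        (weightOfLabels a + spinWeight l 1 (-1) (-1) 1) N c ∧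
      IsComponentWithMEigenvalue (two_le_of_four_le hl)
        (weightOfLabels a + spinWeight l (-1) 1 1 (-1)) N' c' ∧
      (c = c' ↔ a (nodeA hl) = a (nodeC hl)) := by
  have hl2 : 2 ≤ l := two_le_of_four_le hl
  obtain ⟨h1, h2, h3, h4, h5, h6⟩ := nodes_ne hl
  have hdom := isDominant_weightOfLabels hl2 a
  obtain ⟨N, hN⟩ := (isChain_DBC hl).exists_component hl2 hV hW
    (by rw [dynkinLabel_fundWeight hl2, if_pos rfl])
    (by rw [dynkinLabel_fundWeight hl2, if_neg h5])
    (by rw [dynkinLabel_fundWeight hl2, if_neg h6]) hdom hC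
  obtain ⟨N', hN'⟩ := (isChain_DBA hl).exists_component hl2 hV hW
    (by rw [dynkinLabel_fundWeight hl2, if_pos rfl])
    (by rw [dynkinLabel_fundWeight hl2, if_neg h5])
    (by rw [dynkinLabel_fundWeight hl2, if_neg h3]) hdom hA
  rw [string_weight_DBC] at hN
  rw [string_weight_DBA] at hN'
  refine ⟨N, N', _, _, isComponentWithMEigenvalue hl2 hV hW hN,
    isComponentWithMEigenvalue hl2 hV hW hN', ?_⟩
  have key := mScalar_eq_iff hl (fundWeight l (nodeD hl)) (weightOfLabels a) 1
  have e1 := dynkinLabel_weightOfLabels hl2 a (nodeA hl)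
  have e2 := dynkinLabel_weightOfLabels hl2 a (nodeC hl)
  rw [dynkinLabel_nodeA] at e1
  rw [dynkinLabel_nodeC] at e2
  rw [key, ← Nat.cast_inj (R := ℂ), ← e1, ← e2]
  constructor <;> intro h <;> linear_combination h

theorem weightOfLabels_single_add_single (j k : Fin l) :
    weightOfLabels (Pi.single j 1 + Pi.single k 1 : Fin l → ℕ) =
      fundWeight l j + fundWeight l k := by
  simp [weightOfLabels, Pi.single_apply, add_smul, Finset.sum_add_distrib]

end Components

end SpinD

/-! ### Assembly of the two claims. -/

theorem proposition5p12 (l : ℕ) (hl : 4 ≤ l) :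
    -- for each of the two spin modules, some dominant `ν` gives two different components of
    -- `V_ω ⊗ V_ν` with the same `M`-eigenvalue
    (∀ k : Fin l, (k.val = l - 2 ∨ k.val = l - 1) →
      ∃ a : Fin l → ℕ,
        SpinD.IrrepExists (SpinD.fundWeight l k) ∧
        SpinD.IrrepExists (SpinD.weightOfLabels a) ∧
        ∀ (V : Type*) (W : Type*)
          [AddCommGroup V] [Module ℂ V] [LieRingModule (SpinD.SoEven l) V]
          [LieModule ℂ (SpinD.SoEven l) V]
          [AddCommGroup W] [Module ℂ W] [LieRingModule (SpinD.SoEven l) W]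
          [LieModule ℂ (SpinD.SoEven l) W],
          SpinD.IsIrrep (SpinD.fundWeight l k) V →
          SpinD.IsIrrep (SpinD.weightOfLabels a) W →
          ∃ (sig tau : Fin l → ℂ) (N N' : LieSubmodule ℂ (SpinD.SoEven l) (V ⊗[ℂ] W)) (c : ℂ),
            sig ≠ tau ∧
            SpinD.IsComponentWithMEigenvalue (by omega) sig N c ∧
            SpinD.IsComponentWithMEigenvalue (by omega) tau N' c) ∧
    -- the explicit pairs of weights and the coincidence conditions: for each model `V` of the
    -- spin module and each `ν = ∑ a_k ω_k` with model `W`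
    (∀ (a : Fin l → ℕ) (V : Type*) (W : Type*)
      [AddCommGroup V] [Module ℂ V] [LieRingModule (SpinD.SoEven l) V]
      [LieModule ℂ (SpinD.SoEven l) V]
      [AddCommGroup W] [Module ℂ W] [LieRingModule (SpinD.SoEven l) W]
      [LieModule ℂ (SpinD.SoEven l) W],
      SpinD.IsIrrep (SpinD.weightOfLabels a) W →
      -- `V_{ω_{l-1}}`, condition `a_{l-3} = a_l`
      (SpinD.IsIrrep (SpinD.fundWeight l ⟨l - 2, by omega⟩) V →
        SpinD.IsWeightOf (SpinD.spinWeight l 1 (-1) (-1) (-1)) V ∧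
        SpinD.IsWeightOf (SpinD.spinWeight l (-1) 1 1 1) V ∧
        (SpinD.IsDominant (SpinD.weightOfLabels a + SpinD.spinWeight l 1 (-1) (-1) (-1)) →
          SpinD.IsDominant (SpinD.weightOfLabels a + SpinD.spinWeight l (-1) 1 1 1) →
          ∃ (N N' : LieSubmodule ℂ (SpinD.SoEven l) (V ⊗[ℂ] W)) (c c' : ℂ),
            SpinD.IsComponentWithMEigenvalue (by omega)
              (SpinD.weightOfLabels a + SpinD.spinWeight l 1 (-1) (-1) (-1)) N c ∧
            SpinD.IsComponentWithMEigenvalue (by omega)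
              (SpinD.weightOfLabels a + SpinD.spinWeight l (-1) 1 1 1) N' c' ∧
            (c = c' ↔ a ⟨l - 4, by omega⟩ = a ⟨l - 1, by omega⟩))) ∧
      -- `V_{ω_l}`, condition `a_{l-3} = a_{l-1}`
      (SpinD.IsIrrep (SpinD.fundWeight l ⟨l - 1, by omega⟩) V →
        SpinD.IsWeightOf (SpinD.spinWeight l 1 (-1) (-1) 1) V ∧
        SpinD.IsWeightOf (SpinD.spinWeight l (-1) 1 1 (-1)) V ∧
        (SpinD.IsDominant (SpinD.weightOfLabels a + SpinD.spinWeight l 1 (-1) (-1) 1) →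
          SpinD.IsDominant (SpinD.weightOfLabels a + SpinD.spinWeight l (-1) 1 1 (-1)) →
          ∃ (N N' : LieSubmodule ℂ (SpinD.SoEven l) (V ⊗[ℂ] W)) (c c' : ℂ),
            SpinD.IsComponentWithMEigenvalue (by omega)
              (SpinD.weightOfLabels a + SpinD.spinWeight l 1 (-1) (-1) 1) N c ∧
            SpinD.IsComponentWithMEigenvalue (by omega)
              (SpinD.weightOfLabels a + SpinD.spinWeight l (-1) 1 1 (-1)) N' c' ∧
            (c = c' ↔ a ⟨l - 4, by omega⟩ = a ⟨l - 2, by omega⟩)))) := by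
  have hl2 : 2 ≤ l := by omega
  obtain ⟨h1, h2, h3, h4, h5, h6⟩ := SpinD.nodes_ne hl
  have label : ∀ (a : Fin l → ℕ) (j : Fin l), a j ≠ 0 →
      SpinD.dynkinLabel (SpinD.weightOfLabels a) j ≠ 0 := by
    intro a j h
    rw [SpinD.dynkinLabel_weightOfLabels hl2, Nat.cast_ne_zero]
    exact h
  refine ⟨fun k hk => ?_, fun a V W _ _ _ _ _ _ _ _ hW => ⟨fun hV => ?_, fun hV => ?_⟩⟩
  · rcases hk with hk | hk
    · obtain rfl : k = SpinD.nodeC hl := Fin.ext hk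
      -- The labels at A and D must be equal for the coincidence and nonzero for the components to
      -- exist; taking both to be 1 suffices.
      refine ⟨Pi.single (SpinD.nodeA hl) 1 + Pi.single (SpinD.nodeD hl) 1,
        SpinD.irrepExists_spin hl2 _ (Or.inl hk), ?_, ?_⟩
      · rw [SpinD.weightOfLabels_single_add_single]
        exact SpinD.irrepExists_add_spin hl2 _ _ (by simp only [SpinD.nodeA]; omega) (Or.inr rfl)
      · intro V W _ _ _ _ _ _ _ _ hV hW
        obtain ⟨N, N', c, c', hN, hN', hc⟩ := SpinD.exists_components_nodeC hl hV hW
          (label _ _ (by simp [h3])) (label _ _ (by simp [h3.symm]))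
        have hcc : c = c' := hc.mpr (by simp [h3, h3.symm])
        subst hcc
        have hne := SpinD.spinWeight_ne hl (SpinD.weightOfLabels
          (Pi.single (SpinD.nodeA hl) 1 + Pi.single (SpinD.nodeD hl) 1)) (-1)
        rw [neg_neg] at hne
        exact ⟨_, _, N, N', c, hne, hN, hN'⟩
    · obtain rfl : k = SpinD.nodeD hl := Fin.ext hk
      -- For the other spin module C takes the place of D.
      refine ⟨Pi.single (SpinD.nodeA hl) 1 + Pi.single (SpinD.nodeC hl) 1,
        SpinD.irrepExists_spin hl2 _ (Or.inr hk), ?_, ?_⟩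
      · rw [SpinD.weightOfLabels_single_add_single]
        exact SpinD.irrepExists_add_spin hl2 _ _ (by simp only [SpinD.nodeA]; omega) (Or.inl rfl)
      · intro V W _ _ _ _ _ _ _ _ hV hW
        obtain ⟨N, N', c, c', hN, hN', hc⟩ := SpinD.exists_components_nodeD hl hV hW
          (label _ _ (by simp [h2])) (label _ _ (by simp [h2.symm]))
        have hcc : c = c' := hc.mpr (by simp [h2, h2.symm])
        subst hcc
        exact ⟨_, _, N, N', c, SpinD.spinWeight_ne hl _ 1, hN, hN'⟩
  · have labC : ∀ j, SpinD.dynkinLabel (SpinD.fundWeight l (SpinD.nodeC hl)) j =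
        if j = SpinD.nodeC hl then 1 else 0 := fun j => SpinD.dynkinLabel_fundWeight hl2 _ j
    have hb := (labC (SpinD.nodeB hl)).trans (if_neg h4)
    refine ⟨?_, ?_, fun hd hd' => ?_⟩
    · rw [← SpinD.string_weight_CBD hl]
      exact (SpinD.isChain_CBD hl).isWeightOf hl2 hV ((labC _).trans (if_pos rfl)) hb
        ((labC _).trans (if_neg h6.symm))
    · rw [← SpinD.string_weight_CBA hl]
      exact (SpinD.isChain_CBA hl).isWeightOf hl2 hV ((labC _).trans (if_pos rfl)) hb
        ((labC _).trans (if_neg h2))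
    -- Dominance enters only through the chain ends: the first weight forces a nonzero label at D,
    -- the second at A.
    · rw [← SpinD.string_weight_CBD hl] at hd
      rw [← SpinD.string_weight_CBA hl] at hd'
      exact SpinD.exists_components_nodeC hl hV hW
        ((SpinD.isChain_CBA hl).label_ne_zero ((labC _).trans (if_neg h2)) hd')
        ((SpinD.isChain_CBD hl).label_ne_zero ((labC _).trans (if_neg h6.symm)) hd)
  · have labD : ∀ j, SpinD.dynkinLabel (SpinD.fundWeight l (SpinD.nodeD hl)) j =
        if j = SpinD.nodeD hl then 1 else 0 := fun j => SpinD.dynkinLabel_fundWeight hl2 _ j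
    have hb := (labD (SpinD.nodeB hl)).trans (if_neg h5)
    refine ⟨?_, ?_, fun hd hd' => ?_⟩
    · rw [← SpinD.string_weight_DBC hl]
      exact (SpinD.isChain_DBC hl).isWeightOf hl2 hV ((labD _).trans (if_pos rfl)) hb
        ((labD _).trans (if_neg h6))
    · rw [← SpinD.string_weight_DBA hl]
      exact (SpinD.isChain_DBA hl).isWeightOf hl2 hV ((labD _).trans (if_pos rfl)) hb
        ((labD _).trans (if_neg h3))
    · rw [← SpinD.string_weight_DBC hl] at hd
      rw [← SpinD.string_weight_DBA hl] at hd'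
      exact SpinD.exists_components_nodeD hl hV hW
        ((SpinD.isChain_DBA hl).label_ne_zero ((labD _).trans (if_neg h3)) hd')
        ((SpinD.isChain_DBC hl).label_ne_zero ((labD _).trans (if_neg h6)) hd)
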